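/- **Setting.** Let $\mathsf T$ be a compactly generated triangulated category (in particular with all small coproducts), with suspension $\Sigma$ and compact objects $\mathsf T^c$. For full subcategories, $\mathsf A^\perp=\{c:\operatorname{Hom}(a,c)=0\ \forall a\in\mathsf A\}$, ${}^\perp\mathsf A=\{c:\operatorname{Hom}(c,a)=0\ \forall a\in\mathsf A\}$, and $\mathsf A\star\mathsf B$ consists of the objects $X$ in a triangle $a\to X\to b\to\Sigma a$ with $a\in\mathsf A$, $b\in\mathsf B$. Let $\operatorname{smd}$ denote closure under direct summands, $\operatorname{coprod}(\mathsf U)$ the closure of $\mathsf U$ under finite direct sums and extensions, $\operatorname{Coprod}_1(\mathsf U)$ the closure of $\mathsf U$ under small coproducts, and $\operatorname{Coprod}_{n+1}(\mathsf U)=\operatorname{Coprod}_1(\mathsf U)\star\operatorname{Coprod}_n(\mathsf U)$. A *generating sequence* is a sequence $\mathcal G=\{\mathcal G^i\}_{i\in\mathbb Z}$ of full subcategories of $\mathsf T^c$ with $\operatorname{smd}(\operatorname{coprod}(\bigcup_i\mathcal G^i))=\mathsf T^c$ and $\Sigma^{-1}\mathcal G^n\cup\mathcal G^n\cup\Sigma\mathcal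 G^n\subseteq\operatorname{smd}(\operatorname{coprod}(\bigcup_{n-1\le i\le n+1}\mathcal G^i))$ for all $n$; it is *finite* if each $\mathcal G^i$ has finitely many objects. Put $\mathcal M^{\mathcal G}_n=\operatorname{smd}(\operatorname{coprod}(\bigcup_{i\le -n}\mathcal G^i))$, $\mathcal R^{\mathcal G}_n={}^\perp\big((\mathcal M^{\mathcal G}_n)^\perp\big)$, and let the *closure of the compacts* be $\overline{\mathsf T^c}=\bigcap_{n\in\mathbb Z}\mathsf T^c\star\mathcal R^{\mathcal G}_n$. An *orthogonal metric* is a sequence $\{\mathcal R_n\}_{n\in\mathbb Z}$ of strictly full subcategories of $\mathsf T$ containing $0$ with $\mathcal R_n\star\mathcal R_n\subseteq\mathcal R_n$, $\Sigma\mathcal R_{n+1}\cup\mathcal R_{n+1}\cup\Sigma^{-1}\mathcal R_{n+1}\subseteq\mathcal R_n$ and ${}^\perp(\mathcal R_n^\perp)=\mathcal R_n$ for all $n$. The category $\mathsf T$ is *$\mathcal G$-quasiapproximable* if there are an orthogonal metric $\mathcal R$ and an integer $A>0$ such that, for all $i,n\in\mathbb Z$: 0. $\mathcal M^{\mathcal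 G}_i\subseteq\bigcup_{|m|\le A}\Sigma^m\mathcal M^{\mathcal G}_{i+1}$; 1. $\mathcal M^{\mathcal G}_{i+A}\subseteq\mathcal R_i\cap\mathsf T^c$; 2. $\operatorname{Hom}(\mathcal G^n,\mathcal R_i)=0$ whenever $n+i\ge A$; 3. every $F\in\mathcal R_i\cap\overline{\mathsf T^c}$ lies in a triangle $E\to F\to D\to\Sigma E$ with $D\in\mathcal R_{i+1}\cap\overline{\mathsf T^c}$ and $E\in\operatorname{smd}\big(\operatorname{Coprod}_A(\bigcup_{-A-i\le j\le A-i}\mathcal G^j)\big)$. If $\mathsf T$ is $R$-linear for a commutative ring $R$, a *$\mathsf T^c$-cohomological functor* is an $R$-linear functor $H:(\mathsf T^c)^{\mathrm{op}}\to\operatorname{Mod}(R)$ such that $H(Z)\to H(Y)\to H(X)$ is exact for every triangle $X\to Y\to Z\to\Sigma X$ with $X,Y,Z\in\mathsf T^c$. It is *$\mathcal G$-semifinite* if $H(X)$ is a finitely generated $R$-module for every $X\in\mathsf T^c$ and there is $N$ with $H(G)=0$ for all $i\ge N$ and all $G\in\mathcal G^i$. **Theorem.** Let $\mathsf T$ be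 $\mathcal G$-quasiapproximable for a finite generating sequence $\mathcal G$. Assume that $\mathsf T$ is an $R$-linear triangulated category for a commutative noetherian ring $R$, and that $\operatorname{Hom}_{\mathsf T}(G,G')$ is a finitely generated $R$-module for all $G,G'\in\bigcup_n\mathcal G^n$. Then the restricted Yoneda functor $$\mathcal Y:\overline{\mathsf T^c}\longrightarrow\operatorname{Hom}\big((\mathsf T^c)^{\mathrm{op}},\operatorname{Mod}(R)\big),\qquad F\longmapsto\operatorname{Hom}_{\mathsf T}(-,F)|_{\mathsf T^c},$$ satisfies: 1. the essential image of $\mathcal Y$ consists exactly of the $\mathcal G$-semifinite $\mathsf T^c$-cohomological functors; 2. $\mathcal Y$ is full. -/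

import Mathlib

open CategoryTheory CategoryTheory.Limits CategoryTheory.Pretriangulated Opposite

universe w v u

noncomputable section

namespace GApprox

variable {C : Type u} [Category.{v} C] [Preadditive C]

/-- Compact objects: `Hom(X, -)` commutes with (small) coproducts. -/
def compacts (C : Type u) [Category.{v} C] [Preadditive C] : ObjectProperty C :=
  fun X ↦ ∀ J : Type v, PreservesColimitsOfShape (Discrete J) (preadditiveCoyoneda.obj (op X))

/-- `add(U)`: the finite direct sums (the empty one included) of objects of `U`. -/
def finiteSums (U : ObjectProperty C) : ObjectProperty C :=
  fun X ↦ ∃ n : ℕ, U.colimitsOfShape (Discrete (Fin n)) X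

/-- `Add(U)`: the arbitrary small coproducts of objects of `U`. -/
def allSums (U : ObjectProperty C) : ObjectProperty C :=
  fun X ↦ ∃ J : Type v, U.colimitsOfShape (Discrete J) X

/-- For a sequence `G` of full subcategories, `G(s)` is the union of the `G n` with `n ∈ s`. -/
def union (G : ℤ → ObjectProperty C) (s : Set ℤ) : ObjectProperty C :=
  fun X ↦ ∃ n ∈ s, G n X

variable [HasZeroObject C] [HasShift C ℤ] [∀ n : ℤ, (shiftFunctor C n).Additive]
  [Pretriangulated C]

/-- `T` is compactly generated: some small set of compact objects detects zero objects
(the existence of coproducts is assumed separately). -/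
def IsCompactlyGenerated (C : Type u) [Category.{v} C] [Preadditive C] [HasZeroObject C]
    [HasShift C ℤ] [∀ n : ℤ, (shiftFunctor C n).Additive] [Pretriangulated C] : Prop :=
  ∃ S : ObjectProperty C, ObjectProperty.Small.{v} S ∧ S ≤ compacts C ∧
    ∀ Y : C, (∀ X : C, S X → ∀ (n : ℤ) (f : X⟦n⟧ ⟶ Y), f = 0) → IsZero Y

/-- `coprod(U)`: the closure of `U` under finite direct sums and extensions. -/
inductive coprod (U : ObjectProperty C) : C → Prop
  | of_mem (X : C) (hX : U X) : coprod U X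
  | sum (n : ℕ) (Y : Fin n → C) (c : Cofan Y) (hc : IsColimit c)
      (hY : ∀ i, coprod U (Y i)) : coprod U c.pt
  | ext (T : Triangle C) (hT : T ∈ distTriang C)
      (h₁ : coprod U T.obj₁) (h₃ : coprod U T.obj₃) : coprod U T.obj₂

/-- `Coprod_n(U)` for `n ≥ 1`: `Coprod_1(U) = Add(U)` and
`Coprod_{n+1}(U) = Add(U) ⋆ Coprod_n(U)`. (The value at `n = 0` is not used.) -/
def bigCoprod (U : ObjectProperty C) (n : ℕ) : ObjectProperty C :=
  (allSums U).extensionProductIter (n - 1)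

/-- The small category `smd(coprod(G(s)))`. -/
def smallGen (G : ℤ → ObjectProperty C) (s : Set ℤ) : ObjectProperty C :=
  ObjectProperty.retractClosure (coprod (union G s))

/-- The big category `smd(Coprod_n(G(s)))`, for `n ≥ 1`. -/
def bigGen (G : ℤ → ObjectProperty C) (s : Set ℤ) (n : ℕ) : ObjectProperty C :=
  (bigCoprod (union G s) n).retractClosure

/-- A generating sequence of full subcategories of the compact objects. -/
structure IsGeneratingSequence (G : ℤ → ObjectProperty C) : Prop where
  le_compacts (n : ℤ) : G n ≤ compacts C
  generates : smallGen G Set.univ = compacts C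
  shift_neg (n : ℤ) (X : C) (hX : G n X) :
    smallGen G (Set.Icc (n - 1) (n + 1)) (X⟦(-1 : ℤ)⟧)
  self (n : ℤ) (X : C) (hX : G n X) : smallGen G (Set.Icc (n - 1) (n + 1)) X
  shift_pos (n : ℤ) (X : C) (hX : G n X) :
    smallGen G (Set.Icc (n - 1) (n + 1)) (X⟦(1 : ℤ)⟧)

/-- A finite generating sequence: each `G n` has only finitely many objects. -/
structure IsFiniteGeneratingSequence (G : ℤ → ObjectProperty C) : Prop
    extends IsGeneratingSequence G where
  finite (n : ℤ) : Set.Finite {X : C | G n X}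

/-- The metric `M^G_n = smd(coprod(G(-∞, -n]))` on the compact objects. -/
def metricM (G : ℤ → ObjectProperty C) (n : ℤ) : ObjectProperty C :=
  smallGen G (Set.Iic (-n))

/-- The metric `R^G_n = ^⊥((M^G_n)^⊥)`. -/
def metricR (G : ℤ → ObjectProperty C) (n : ℤ) : ObjectProperty C :=
  (metricM G n).rightOrthogonal.leftOrthogonal

/-- An extended good metric. -/
structure IsExtendedGoodMetric (M : ℤ → ObjectProperty C) : Prop where
  iso_closed (n : ℤ) : (M n).IsClosedUnderIsomorphisms
  zero (n : ℤ) : (M n).ContainsZero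
  ext (n : ℤ) : (M n).extensionProduct (M n) ≤ M n
  shift_pos (n : ℤ) (X : C) (hX : M (n + 1) X) : M n (X⟦(1 : ℤ)⟧)
  self (n : ℤ) : M (n + 1) ≤ M n
  shift_neg (n : ℤ) (X : C) (hX : M (n + 1) X) : M n (X⟦(-1 : ℤ)⟧)

/-- An orthogonal metric: an extended good metric with `^⊥(M_n^⊥) = M_n`. -/
structure IsOrthogonalMetric (M : ℤ → ObjectProperty C) : Prop
    extends IsExtendedGoodMetric M where
  orthogonal (n : ℤ) : (M n).rightOrthogonal.leftOrthogonal = M n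

/-- The closure of the compacts with respect to a metric: `⋂ n, T^c ⋆ M_n`. -/
def closureOfCompacts (M : ℤ → ObjectProperty C) : ObjectProperty C :=
  fun X ↦ ∀ n : ℤ, (compacts C).extensionProduct (M n) X

/-- The closure of the compacts of a category with a generating sequence `G`:
it is taken with respect to the metric `R^G`. -/
def closureG (G : ℤ → ObjectProperty C) : ObjectProperty C :=
  closureOfCompacts (metricR G)

/-- The orthogonal metric `R` and the integer `A` witness `G`-preapproximability. -/
structure IsPreapproximableWith (G : ℤ → ObjectProperty C) (R : ℤ → ObjectProperty C)
    (A : ℕ) : Prop where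
  pos : 0 < A
  metric : IsOrthogonalMetric R
  /-- `M^G_i ⊆ ⋃_{|n| ≤ A} Σ^n M^G_{i+1}` -/
  shift_bound (i : ℤ) (X : C) (hX : metricM G i X) :
    ∃ n : ℤ, |n| ≤ (A : ℤ) ∧ ∃ Y : C, metricM G (i + 1) Y ∧ Nonempty (X ≅ Y⟦n⟧)
  metricM_le (i : ℤ) : metricM G (i + A) ≤ R i ⊓ compacts C
  hom_eq_zero (n : ℤ) : ∃ N : ℤ, ∀ i : ℤ, N ≤ i → R i ≤ (G n).rightOrthogonal

/-- The orthogonal metric `R` and the integer `A` witness `G`-quasiapproximability. -/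
structure IsQuasiapproximableWith (G : ℤ → ObjectProperty C) (R : ℤ → ObjectProperty C)
    (A : ℕ) : Prop extends IsPreapproximableWith G R A where
  hom_eq_zero_of_le (n i : ℤ) (h : (A : ℤ) ≤ n + i) : R i ≤ (G n).rightOrthogonal
  approx (i : ℤ) (F : C) (hF : R i F) (hF' : closureG G F) :
    ∃ (E D : C) (a : E ⟶ F) (b : F ⟶ D) (c : D ⟶ E⟦(1 : ℤ)⟧),
      Triangle.mk a b c ∈ distTriang C ∧
      bigGen G (Set.Icc (-A - i) (A - i)) A E ∧ R (i + 1) D ∧ closureG G D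

/-- `T` is `G`-quasiapproximable. -/
def IsQuasiapproximable (G : ℤ → ObjectProperty C) : Prop :=
  ∃ (R : ℤ → ObjectProperty C) (A : ℕ), IsQuasiapproximableWith G R A

variable (k : Type w) [CommRing k] [Linear k C]

/-- `T^c`-cohomological functors: `k`-linear functors `H : (T^c)ᵒᵖ ⥤ Mod(k)` such that
`H(Z) ⟶ H(Y) ⟶ H(X)` is exact for each distinguished triangle `X ⟶ Y ⟶ Z ⟶ ΣX`
with `X`, `Y` and `Z` compact. -/
structure IsCohomological (H : (compacts C).FullSubcategoryᵒᵖ ⥤ ModuleCat.{v} k) : Prop where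
  additive : H.Additive
  map_smul {X Y : (compacts C).FullSubcategory} (r : k) (f : X ⟶ Y) :
    H.map (r • f).op = r • H.map f.op
  exact {X Y Z : (compacts C).FullSubcategory} (f : X ⟶ Y) (g : Y ⟶ Z)
    (h : Z.obj ⟶ X.obj⟦(1 : ℤ)⟧) (hT : Triangle.mk f.hom g.hom h ∈ distTriang C) :
    Function.Exact (H.map g.op).hom (H.map f.op).hom

/-- `G`-semifinite `T^c`-cohomological functors: the values are finitely generated modules,
and `H(G^i) = 0` for `i ≫ 0`. -/
structure IsSemifinite (G : ℤ → ObjectProperty C)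
    (H : (compacts C).FullSubcategoryᵒᵖ ⥤ ModuleCat.{v} k) : Prop
    extends IsCohomological k H where
  finite (X : (compacts C).FullSubcategory) : Module.Finite k (H.obj (op X))
  vanishing : ∃ N : ℤ, ∀ i : ℤ, N ≤ i → ∀ X : (compacts C).FullSubcategory, G i X.obj →
    Subsingleton (H.obj (op X))

/-- The restricted Yoneda functor `F ↦ Hom(-, F)|_{T^c}` on the closure of the compacts. -/
def restrictedYoneda (G : ℤ → ObjectProperty C) :
    (closureG G).FullSubcategory ⥤
      ((compacts C).FullSubcategoryᵒᵖ ⥤ ModuleCat.{v} k) :=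
  (closureG G).ι ⋙ linearYoneda k C ⋙
    (Functor.whiskeringLeft _ _ _).obj (compacts C).ι.op

end GApprox

end

noncomputable section

namespace GApprox

/-!
A semifinite cohomological functor `H` is the colimit of `Hom(-, Eⱼ)` for a sequence of compact
objects `Eⱼ` in which each transition map kills the kernel of `Hom(-, Eⱼ) ⟶ H` on more and more
shifts of the finitely many generators; hence `H ≅ Hom(-, F)` on compacts for the homotopy colimit
`F` of the `Eⱼ`. The same construction for `H = Hom(-, F)` exhibits every `F` with finitely
generated Homs from compacts as a homotopy colimit of compacts. A natural transformation out of
`Hom(-, F)` is a cocone on the compacts `Eⱼ`, and so comes from a morphism: this is fullness.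

It remains to see that such an `F` with `Hom(Gⁿ, F) = 0` for `n ≫ 0` is in the closure. Choose
`a : E₀ ⟶ E₁` between compacts over `F`, with `E₁` as small as `F` in the metric, such that every
morphism to `F` from the generators in question, or from an object built from them in a bounded
number of steps, lifts along `p₀ : E₀ ⟶ F`, and such that `a` kills the morphisms from generators
that die in `F`. In a triangle `P ⟶ E₁ ⟶ K` with `K` very small, where `P ⟶ E₁` factors through an
object so built, the composite `P ⟶ E₁ ⟶ F` lifts to `v : P ⟶ E₀`. Up to the metric `P` is `E₁`
and `v ≫ a` is an idempotent of `E₁` with image `F`, so the cone of `(P ⟶ E₁) - v ≫ a`, which is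
compact, is `F ⊞ ΣF` up to the metric. Thus `F ⊞ ΣF` is in the closure, hence so is `F ⊞ Σ²ᵗ⁺¹F` for
every `t`; as some `Σ²ᵗ⁺¹F` is small, `F` is in the closure as well.
-/

section Coproducts

variable {C : Type u} [Category.{v} C] [Preadditive C] {J : Type*} {f : J → C} {c : Cofan f}

open Classical in
/-- The projection of a coproduct onto one of its summands: the identity on that summand and zero
on the other ones. -/
def cofanProj (hc : IsColimit c) (j : J) : c.pt ⟶ f j :=
  Cofan.IsColimit.desc hc (Pi.single (M := fun i ↦ f i ⟶ f j) j (𝟙 (f j)))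

@[simp]
lemma inj_cofanProj_self (hc : IsColimit c) (j : J) : c.inj j ≫ cofanProj hc j = 𝟙 (f j) := by
  simp [cofanProj]

lemma inj_cofanProj_of_ne (hc : IsColimit c) {i j : J} (h : i ≠ j) :
    c.inj i ≫ cofanProj hc j = 0 := by
  simp [cofanProj, h]

lemma sum_comp_cofanProj (hc : IsColimit c) {X : C} {s : Finset J} (g : ∀ j, X ⟶ f j) {j : J}
    (hj : j ∈ s) : (∑ i ∈ s, g i ≫ c.inj i) ≫ cofanProj hc j = g j := by
  classical
  rw [Preadditive.sum_comp, Finset.sum_eq_single j]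
  · simp
  · intro i _ hij
    simp [inj_cofanProj_of_ne hc hij]
  · exact fun h ↦ (h hj).elim

/-- A morphism to a coproduct has finite support if it is a finite sum of morphisms factoring
through the summands. -/
def HasFiniteSupport (c : Cofan f) {X : C} (q : X ⟶ c.pt) : Prop :=
  ∃ (s : Finset J) (g : ∀ j, X ⟶ f j), ∑ j ∈ s, g j ≫ c.inj j = q

lemma HasFiniteSupport.zero {X : C} : HasFiniteSupport c (0 : X ⟶ c.pt) :=
  ⟨∅, 0, rfl⟩

lemma HasFiniteSupport.comp_inj {X : C} {j : J} (g : X ⟶ f j) :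
    HasFiniteSupport c (g ≫ c.inj j) := by
  classical
  exact ⟨{j}, Pi.single (M := fun i ↦ X ⟶ f i) j g, by simp⟩

lemma HasFiniteSupport.precomp {X Y : C} {q : Y ⟶ c.pt} (h : HasFiniteSupport c q)
    (a : X ⟶ Y) : HasFiniteSupport c (a ≫ q) := by
  obtain ⟨s, g, rfl⟩ := h
  exact ⟨s, fun j ↦ a ≫ g j, by simp [Preadditive.comp_sum]⟩

lemma HasFiniteSupport.neg {X : C} {q : X ⟶ c.pt} (h : HasFiniteSupport c q) :
    HasFiniteSupport c (-q) := by
  simpa using h.precomp (-𝟙 X)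

lemma HasFiniteSupport.add {X : C} {p q : X ⟶ c.pt} (hp : HasFiniteSupport c p)
    (hq : HasFiniteSupport c q) : HasFiniteSupport c (p + q) := by
  classical
  obtain ⟨s, g, rfl⟩ := hp
  obtain ⟨t, h, rfl⟩ := hq
  refine ⟨s ∪ t, fun j ↦ (if j ∈ s then g j else 0) + if j ∈ t then h j else 0, ?_⟩
  simp only [Preadditive.add_comp, ite_comp, zero_comp, Finset.sum_add_distrib,
    Finset.sum_ite_mem, Finset.union_inter_cancel_left, Finset.union_inter_cancel_right]

lemma hasFiniteSupport_of_compacts [Small.{v} J] {X : C} (hX : compacts C X) (hc : IsColimit c)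
    (q : X ⟶ c.pt) : HasFiniteSupport c q := by
  have := hX (Shrink J)
  have := preservesColimitsOfShape_of_equiv (Discrete.equivalence (equivShrink J).symm)
    (preadditiveCoyoneda.obj (op X))
  let N : AddSubgroup (X ⟶ c.pt) :=
    { carrier := {q | HasFiniteSupport c q}
      zero_mem' := HasFiniteSupport.zero
      add_mem' := HasFiniteSupport.add
      neg_mem' := HasFiniteSupport.neg }
  -- The quotient map by `N` vanishes on all summands of the coproduct `Hom(X, c.pt)`.
  have key : (AddCommGrpCat.ofHom (QuotientAddGroup.mk' N) :
      (preadditiveCoyoneda.obj (op X)).obj c.pt ⟶ AddCommGrpCat.of ((X ⟶ c.pt) ⧸ N)) = 0 := by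
    refine (isColimitOfPreserves (preadditiveCoyoneda.obj (op X)) hc).hom_ext fun ⟨j⟩ ↦ ?_
    ext (g : X ⟶ f j)
    exact (QuotientAddGroup.eq_zero_iff _).2 (HasFiniteSupport.comp_inj g)
  exact (QuotientAddGroup.eq_zero_iff q).1
    (DFunLike.congr_fun (congrArg AddCommGrpCat.Hom.hom key) q)

open Classical in
/-- The sum map from the direct sum of the groups `Hom(X, f j)` to `Hom(X, ∐ f)`. -/
def directSumHom (c : Cofan f) (X : C) : (Π₀ j, X ⟶ f j) →+ (X ⟶ c.pt) :=
  DFinsupp.liftAddHom fun j ↦ Preadditive.rightComp X (c.inj j)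

open Classical in
@[simp]
lemma directSumHom_single {X : C} {j : J} (g : X ⟶ f j) :
    directSumHom c X (DFinsupp.single j g) = g ≫ c.inj j :=
  DFinsupp.liftAddHom_apply_single (fun j ↦ Preadditive.rightComp X (c.inj j)) j g

lemma directSumHom_comp_cofanProj (hc : IsColimit c) {X : C} (x : Π₀ j, X ⟶ f j) (j : J) :
    directSumHom c X x ≫ cofanProj hc j = x j := by
  classical
  induction x using DFinsupp.induction with
  | h0 => simp
  | ha i g x _ _ ih =>
    rw [map_add, Preadditive.add_comp, ih, directSumHom_single, DFinsupp.add_apply]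
    congr 1
    obtain rfl | hij := eq_or_ne j i
    · simp
    · simp [inj_cofanProj_of_ne hc hij.symm, DFinsupp.single_eq_of_ne hij]

lemma directSumHom_injective (hc : IsColimit c) (X : C) :
    Function.Injective (directSumHom c X) := fun x y h ↦ by
  ext j
  rw [← directSumHom_comp_cofanProj hc x, h, directSumHom_comp_cofanProj]

lemma HasFiniteSupport.exists_directSumHom_eq {X : C} {q : X ⟶ c.pt}
    (h : HasFiniteSupport c q) : ∃ x, directSumHom c X x = q := by
  classical
  obtain ⟨s, g, rfl⟩ := h
  exact ⟨∑ j ∈ s, DFinsupp.single j (g j), by simp⟩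

lemma existsUnique_hom_of_hasFiniteSupport (hc : IsColimit c) {X : C}
    (h : ∀ q : X ⟶ c.pt, HasFiniteSupport c q) {A : Type*} [AddCommGroup A]
    (φ : ∀ j, (X ⟶ f j) →+ A) :
    ∃! ψ : (X ⟶ c.pt) →+ A, ∀ j (g : X ⟶ f j), ψ (g ≫ c.inj j) = φ j g := by
  classical
  let e : (Π₀ j, X ⟶ f j) ≃+ (X ⟶ c.pt) := AddEquiv.ofBijective (directSumHom c X)
    ⟨directSumHom_injective hc X, fun q ↦ (h q).exists_directSumHom_eq⟩
  have he {j : J} (g : X ⟶ f j) : e (DFinsupp.single j g) = g ≫ c.inj j := directSumHom_single g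
  refine ⟨(DFinsupp.liftAddHom φ).comp e.symm.toAddMonoidHom, fun j g ↦ ?_, fun ψ hψ ↦ ?_⟩
  · simp [← he]
  · have : ψ.comp e.toAddMonoidHom = DFinsupp.liftAddHom φ :=
      DFinsupp.addHom_ext fun j g ↦ by simp [he, hψ]
    ext q
    simp [← this]

end Coproducts

section Compacts

variable {C : Type u} [Category.{v} C] [Preadditive C]

lemma compacts_of_hasFiniteSupport {X : C}
    (h : ∀ {J : Type v} {f : J → C} {c : Cofan f}, IsColimit c →
      ∀ q : X ⟶ c.pt, HasFiniteSupport c q) : compacts C X := fun J ↦ by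
  have (f : J → C) : PreservesColimit (Discrete.functor f) (preadditiveCoyoneda.obj (op X)) := by
    refine ⟨fun {c} hc ↦ ⟨IsColimit.ofExistsUnique fun s ↦ ?_⟩⟩
    obtain ⟨ψ, hψ, hψ'⟩ := existsUnique_hom_of_hasFiniteSupport hc (h hc)
      fun j ↦ show (X ⟶ f j) →+ s.pt from (s.ι.app ⟨j⟩).hom
    refine ⟨AddCommGrpCat.ofHom ψ, fun ⟨j⟩ ↦ ?_, fun ψ' h' ↦ ?_⟩
    · ext (g : X ⟶ f j)
      exact hψ j g
    · ext1
      exact hψ' ψ'.hom fun j g ↦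
        DFunLike.congr_fun (congrArg AddCommGrpCat.Hom.hom (h' ⟨j⟩)) g
  exact preservesColimitsOfShape_of_discrete _

instance : (compacts C).IsStableUnderRetracts where
  of_retract r hY := compacts_of_hasFiniteSupport fun hc q ↦ by
    simpa using (hasFiniteSupport_of_compacts hY hc (r.r ≫ q)).precomp r.i

instance [HasZeroObject C] : (compacts C).ContainsZero where
  exists_zero := ⟨_, isZero_zero C, compacts_of_hasFiniteSupport fun _ q ↦ by
    rw [(isZero_zero C).eq_of_src q 0]
    exact .zero⟩

variable [HasZeroObject C] [HasShift C ℤ] [∀ n : ℤ, (shiftFunctor C n).Additive]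
  [Pretriangulated C]

instance : (compacts C).IsTriangulatedClosed₂ := .mk' fun T hT h₁ h₃ ↦ by
  refine compacts_of_hasFiniteSupport fun {J f c} hc q ↦ ?_
  obtain ⟨s, g, hg⟩ := hasFiniteSupport_of_compacts h₁ hc (T.mor₁ ≫ q)
  -- The part of `q` supported on `s` agrees with `q` after restriction along `T.mor₁`.
  let q₀ := ∑ j ∈ s, (q ≫ cofanProj hc j) ≫ c.inj j
  have hq₀ : T.mor₁ ≫ (q - q₀) = 0 := by
    rw [Preadditive.comp_sub, sub_eq_zero, ← hg, Preadditive.comp_sum]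
    refine Finset.sum_congr rfl fun j hj ↦ ?_
    rw [← sum_comp_cofanProj hc g hj, hg]
    simp only [Category.assoc]
  obtain ⟨w, hw⟩ := Triangle.yoneda_exact₂ T hT _ hq₀
  rw [← sub_add_cancel q q₀, hw]
  exact ((hasFiniteSupport_of_compacts h₃ hc w).precomp T.mor₂).add ⟨s, _, rfl⟩

instance : (compacts C).IsStableUnderShift ℤ where
  isStableUnderShiftBy n := ⟨fun X hX J ↦ by
    have := hX J
    have : (shiftEquiv C n).functor.Additive := inferInstanceAs (shiftFunctor C n).Additive
    let e : preadditiveCoyoneda.obj (op (X⟦n⟧)) ≅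
        shiftFunctor C (-n) ⋙ preadditiveCoyoneda.obj (op X) :=
      NatIso.ofComponents (fun Y ↦ AddEquiv.toAddCommGrpIso
        ((shiftEquiv C n).toAdjunction.homAddEquiv X Y)) fun {Y Z} f ↦ by
          ext (g : X⟦n⟧ ⟶ Y)
          exact (shiftEquiv C n).toAdjunction.homEquiv_naturality_right g f
    exact preservesColimitsOfShape_of_natIso e.symm⟩

instance : (compacts C).IsTriangulated where

end Compacts

section Telescope

variable {C : Type u} [Category.{v} C] [Preadditive C] (X : ℕ ⥤ C) [HasCoproduct X.obj]

/-- The morphism `1 - shift` on the coproduct of a sequence, whose cone is the homotopy colimit of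
the sequence. -/
def telescope : ∐ X.obj ⟶ ∐ X.obj :=
  Sigma.desc fun j ↦ Sigma.ι X.obj j - X.map (homOfLE j.le_succ) ≫ Sigma.ι X.obj (j + 1)

lemma ι_telescope (j : ℕ) : Sigma.ι X.obj j ≫ telescope X =
    Sigma.ι X.obj j - X.map (homOfLE j.le_succ) ≫ Sigma.ι X.obj (j + 1) :=
  Sigma.ι_desc _ _

lemma telescope_comp_desc (c : Cocone X) : telescope X ≫ Sigma.desc c.ι.app = 0 :=
  Sigma.hom_ext _ _ fun j ↦ by simp [telescope]

/-- The morphism from the coproduct of a sequence to its `n`-th object which is given by the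
transition maps on the objects up to `n` and is zero on the later ones. -/
def toStage (n : ℕ) : ∐ X.obj ⟶ X.obj n :=
  Sigma.desc fun j ↦ if h : j ≤ n then X.map (homOfLE h) else 0

lemma ι_toStage {j n : ℕ} (h : j ≤ n) : Sigma.ι X.obj j ≫ toStage X n = X.map (homOfLE h) := by
  simp [toStage, h]

lemma ι_toStage_of_lt {j n : ℕ} (h : n < j) : Sigma.ι X.obj j ≫ toStage X n = 0 := by
  simp [toStage, h]

lemma ι_telescope_toStage (j n : ℕ) : Sigma.ι X.obj j ≫ telescope X ≫ toStage X n =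
    Sigma.ι X.obj j ≫ toStage X n -
      X.map (homOfLE j.le_succ) ≫ Sigma.ι X.obj (j + 1) ≫ toStage X n := by
  rw [← Category.assoc, ι_telescope, Preadditive.sub_comp, Category.assoc]

lemma ι_telescope_toStage_of_lt {j n : ℕ} (h : j < n) :
    Sigma.ι X.obj j ≫ telescope X ≫ toStage X n = 0 := by
  rw [ι_telescope_toStage, ι_toStage X h.le, ι_toStage X (show j + 1 ≤ n from h),
    ← X.map_comp, homOfLE_comp, sub_self]

lemma telescope_toStage (n : ℕ) :
    telescope X ≫ toStage X n = cofanProj (coproductIsCoproduct X.obj) n := by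
  refine Sigma.hom_ext _ _ fun j ↦ ?_
  change _ = (Cofan.mk _ (Sigma.ι X.obj)).inj j ≫ _
  obtain h | rfl | h := lt_trichotomy j n
  · rw [ι_telescope_toStage_of_lt X h, inj_cofanProj_of_ne _ h.ne]
  · rw [ι_telescope_toStage, ι_toStage X le_rfl, ι_toStage_of_lt X j.lt_succ_self, comp_zero,
      sub_zero, inj_cofanProj_self]
    exact X.map_id j
  · rw [ι_telescope_toStage, ι_toStage_of_lt X h, ι_toStage_of_lt X (h.trans j.lt_succ_self),
      comp_zero, sub_zero, inj_cofanProj_of_ne _ h.ne']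

variable {X} {Q : C}

lemma eq_zero_of_comp_telescope_eq_zero (hQ : compacts C Q) {q : Q ⟶ ∐ X.obj}
    (hq : q ≫ telescope X = 0) : q = 0 := by
  obtain ⟨s, g, hg⟩ := hasFiniteSupport_of_compacts hQ (coproductIsCoproduct X.obj) q
  rw [← hg]
  refine Finset.sum_eq_zero fun j hj ↦ ?_
  rw [← sum_comp_cofanProj (coproductIsCoproduct X.obj) g hj, hg, ← telescope_toStage,
    ← Category.assoc q, hq, zero_comp, zero_comp]

lemma exists_comp_toStage_comp_eq (hQ : compacts C Q) (q : Q ⟶ ∐ X.obj) (c : Cocone X) :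
    ∃ n, q ≫ toStage X n ≫ c.ι.app n = q ≫ Sigma.desc c.ι.app := by
  obtain ⟨s, g, rfl⟩ := hasFiniteSupport_of_compacts hQ (coproductIsCoproduct X.obj) q
  refine ⟨s.sup id, ?_⟩
  simp only [Preadditive.sum_comp]
  refine Finset.sum_congr rfl fun j hj ↦ ?_
  have h := ι_toStage X (show j ≤ s.sup id from Finset.le_sup (f := id) hj)
  simp only [Category.assoc]
  change g j ≫ Sigma.ι X.obj j ≫ _ ≫ _ = g j ≫ Sigma.ι X.obj j ≫ _
  rw [reassoc_of% h, c.w, Sigma.ι_desc]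

lemma exists_comp_telescope_toStage_eq_zero (hQ : compacts C Q) (q : Q ⟶ ∐ X.obj) :
    ∃ N, ∀ n, N < n → q ≫ telescope X ≫ toStage X n = 0 := by
  obtain ⟨s, g, rfl⟩ := hasFiniteSupport_of_compacts hQ (coproductIsCoproduct X.obj) q
  refine ⟨s.sup id, fun n hn ↦ ?_⟩
  rw [Preadditive.sum_comp]
  refine Finset.sum_eq_zero fun j hj ↦ ?_
  have h := ι_telescope_toStage_of_lt X ((Finset.le_sup (f := id) hj).trans_lt hn)
  rw [Category.assoc]
  exact (congrArg _ h).trans comp_zero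

end Telescope

section HomotopyColimit

variable {C : Type u} [Category.{v} C] [Preadditive C] [HasZeroObject C] [HasShift C ℤ]
  [∀ n : ℤ, (shiftFunctor C n).Additive] [Pretriangulated C] {X : ℕ ⥤ C} [HasCoproduct X.obj]

/-- A cocone exhibits its point as the homotopy colimit of the sequence `X` if it is induced by
the second morphism of a distinguished triangle on `telescope X`. -/
def IsHomotopyColimit (c : Cocone X) : Prop :=
  ∃ δ : c.pt ⟶ (∐ X.obj)⟦(1 : ℤ)⟧,
    Triangle.mk (telescope X) (Sigma.desc c.ι.app) δ ∈ distTriang C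

variable (X) in
lemma exists_isHomotopyColimit : ∃ c : Cocone X, IsHomotopyColimit c := by
  obtain ⟨L, g, δ, hT⟩ := distinguished_cocone_triangle (telescope X)
  have hg : telescope X ≫ g = 0 := comp_distTriang_mor_zero₁₂ _ hT
  let c : Cocone X :=
    { pt := L
      ι := NatTrans.ofSequence (fun j ↦ Sigma.ι X.obj j ≫ g) fun j ↦ by
        have h := congrArg (Sigma.ι X.obj j ≫ ·) hg
        simp only [← Category.assoc, ι_telescope, Preadditive.sub_comp, comp_zero,
          sub_eq_zero] at h
        simpa using h.symm }
  have hc : Sigma.desc c.ι.app = g := Sigma.hom_ext _ _ fun j ↦ by simp [c]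
  exact ⟨c, δ, hc ▸ hT⟩

namespace IsHomotopyColimit

variable {c : Cocone X} (hc : IsHomotopyColimit c)
include hc

lemma exists_desc (c' : Cocone X) : ∃ f : c.pt ⟶ c'.pt, ∀ j, c.ι.app j ≫ f = c'.ι.app j := by
  obtain ⟨δ, hT⟩ := hc
  obtain ⟨f : c.pt ⟶ c'.pt, hf : Sigma.desc c'.ι.app = Sigma.desc c.ι.app ≫ f⟩ :=
    Triangle.yoneda_exact₂ _ hT _ (telescope_comp_desc X c')
  refine ⟨f, fun j ↦ ?_⟩
  rw [← Sigma.ι_desc c'.ι.app j, hf, ← Category.assoc, Sigma.ι_desc]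

lemma leftOrthogonal_pt {P : ObjectProperty C} (h₀ : ∀ j, P.leftOrthogonal (X.obj j))
    (h₁ : ∀ j, P.leftOrthogonal ((X.obj j)⟦(1 : ℤ)⟧)) : P.leftOrthogonal c.pt := by
  intro Y f hY
  obtain ⟨δ, hT⟩ := hc
  obtain ⟨g : (∐ X.obj)⟦(1 : ℤ)⟧ ⟶ Y, hg : f = δ ≫ g⟩ := Triangle.yoneda_exact₃ _ hT f
    (Sigma.hom_ext _ _ fun j ↦ (h₀ j _ hY).trans comp_zero.symm)
  have hg₀ : g = 0 := (isColimitOfPreserves (shiftFunctor C (1 : ℤ))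
    (coproductIsCoproduct X.obj)).hom_ext fun j ↦ (h₁ j.as _ hY).trans comp_zero.symm
  rw [hg, hg₀, comp_zero]

variable {Q : C} (hQ : compacts C Q)
include hQ

lemma exists_lift (q : Q ⟶ c.pt) : ∃ (j : ℕ) (y : Q ⟶ X.obj j), y ≫ c.ι.app j = q := by
  obtain ⟨δ, hT⟩ := hc
  have hδ : q ≫ δ = 0 := by
    obtain ⟨y, hy⟩ := (shiftFunctor C (1 : ℤ)).map_surjective
      ((shiftNegShift Q (1 : ℤ)).hom ≫ q ≫ δ)
    have hy₀ : y ≫ telescope X = 0 := (shiftFunctor C (1 : ℤ)).map_injective (by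
      have h : δ ≫ (telescope X)⟦(1 : ℤ)⟧' = 0 := comp_distTriang_mor_zero₃₁ _ hT
      rw [Functor.map_comp, hy, Category.assoc, Category.assoc, h, comp_zero, comp_zero,
        Functor.map_zero])
    rw [← cancel_epi (shiftNegShift Q (1 : ℤ)).hom, ← hy,
      eq_zero_of_comp_telescope_eq_zero ((compacts C).le_shift (-1) Q hQ) hy₀,
      Functor.map_zero, comp_zero]
  obtain ⟨z : Q ⟶ ∐ X.obj, hz : q = z ≫ Sigma.desc c.ι.app⟩ :=
    Triangle.coyoneda_exact₃ _ hT q hδ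
  obtain ⟨n, hn⟩ := exists_comp_toStage_comp_eq hQ z c
  exact ⟨n, z ≫ toStage X n, by rw [Category.assoc, hn, hz]⟩

lemma exists_eq_zero {j : ℕ} {y : Q ⟶ X.obj j} (hy : y ≫ c.ι.app j = 0) :
    ∃ (n : ℕ) (h : j ≤ n), y ≫ X.map (homOfLE h) = 0 := by
  obtain ⟨δ, hT⟩ := hc
  obtain ⟨z : Q ⟶ ∐ X.obj, hz : y ≫ Sigma.ι X.obj j = z ≫ telescope X⟩ :=
    Triangle.coyoneda_exact₂ _ hT (y ≫ Sigma.ι X.obj j) (by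
      change (y ≫ Sigma.ι X.obj j) ≫ Sigma.desc c.ι.app = 0
      rwa [Category.assoc, Sigma.ι_desc])
  obtain ⟨N, hN⟩ := exists_comp_telescope_toStage_eq_zero hQ z
  refine ⟨j + N + 1, by lia, ?_⟩
  rw [← ι_toStage X (show j ≤ j + N + 1 by lia), ← Category.assoc, hz, Category.assoc,
    hN _ (by lia)]

end IsHomotopyColimit

end HomotopyColimit

section Devissage

variable {C : Type u} [Category.{v} C] [Preadditive C] [HasZeroObject C] [HasShift C ℤ]
  [∀ n : ℤ, (shiftFunctor C n).Additive] [Pretriangulated C] {P : ObjectProperty C}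
  [P.ContainsZero] [P.IsTriangulatedClosed₂]

lemma isClosedUnderFiniteCoproducts_of_isTriangulatedClosed₂ [P.IsClosedUnderIsomorphisms] :
    P.IsClosedUnderFiniteCoproducts := by
  have : P.IsClosedUnderBinaryCoproducts := ⟨by
    rintro X ⟨p⟩
    exact P.prop_of_iso
      ((BinaryBiproduct.isColimit _ _).coconePointsIsoOfNatIso p.isColimit
        (diagramIsoPair p.diag).symm)
      (P.ext_of_isTriangulatedClosed₂ _ (binaryBiproductTriangle_distinguished _ _)
        (p.prop_diag_obj ⟨.left⟩) (p.prop_diag_obj ⟨.right⟩))⟩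
  exact .mk'

lemma coprod_le [P.IsClosedUnderIsomorphisms] {U : ObjectProperty C} (hU : U ≤ P) :
    coprod U ≤ P := by
  intro X hX
  induction hX with
  | of_mem X hX => exact hU X hX
  | sum n Y c hc _ ih =>
    have := isClosedUnderFiniteCoproducts_of_isTriangulatedClosed₂ (P := P)
    exact P.prop_of_isColimit_cofan hc ih
  | ext T hT _ _ h₁ h₃ => exact P.ext_of_isTriangulatedClosed₂ T hT h₁ h₃

lemma smallGen_le [P.IsStableUnderRetracts] {G : ℤ → ObjectProperty C} {s : Set ℤ}
    (hG : ∀ n ∈ s, G n ≤ P) : smallGen G s ≤ P := by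
  refine (ObjectProperty.retractClosure_le_iff _ P).2 (coprod_le ?_)
  rintro X ⟨n, hn, hX⟩
  exact hG n hn X hX

end Devissage

section CompactYoneda

variable {C : Type u} [Category.{v} C] [Preadditive C] (k : Type w) [CommRing k] [Linear k C]

/-- The functor sending `L` to `Hom(-, L)` restricted to the compact objects. -/
def compactYoneda : C ⥤ ((compacts C).FullSubcategoryᵒᵖ ⥤ ModuleCat.{v} k) :=
  linearYoneda k C ⋙ (Functor.whiskeringLeft _ _ _).obj (compacts C).ι.op

variable {k} {H : (compacts C).FullSubcategoryᵒᵖ ⥤ ModuleCat.{v} k} {L L' : C}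
  {Q Q' E : (compacts C).FullSubcategory}

/-- The value of a natural transformation `Hom(-, L) ⟶ H` at a compact object `Q`, as a linear
map on morphisms of `C`. -/
def evalAt (φ : (compactYoneda k).obj L ⟶ H) (Q : (compacts C).FullSubcategory) :
    (Q.obj ⟶ L) →ₗ[k] H.obj (op Q) :=
  (φ.app (op Q)).hom

lemma evalAt_comp (φ : (compactYoneda k).obj L ⟶ H) (f : Q' ⟶ Q) (q : Q.obj ⟶ L) :
    evalAt φ Q' (f.hom ≫ q) = H.map f.op (evalAt φ Q q) :=
  NatTrans.naturality_apply φ f.op q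

lemma evalAt_map_comp (t : L ⟶ L') (φ : (compactYoneda k).obj L' ⟶ H) (q : Q.obj ⟶ L) :
    evalAt ((compactYoneda k).map t ≫ φ) Q q = evalAt φ Q (q ≫ t) :=
  rfl

lemma evalAt_eq_map (φ : (compactYoneda k).obj E.obj ⟶ H) (f : Q ⟶ E) :
    evalAt φ Q f.hom = H.map f.op (evalAt φ E (𝟙 E.obj)) := by
  rw [← evalAt_comp, Category.comp_id]

lemma compactYoneda_hom_ext {φ ψ : (compactYoneda k).obj L ⟶ H}
    (h : ∀ (Q : (compacts C).FullSubcategory) (q : Q.obj ⟶ L), evalAt φ Q q = evalAt ψ Q q) :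
    φ = ψ := by
  ext Q q
  exact h Q.unop q

lemma compactYoneda_hom_ext_of_compact {φ ψ : (compactYoneda k).obj E.obj ⟶ H}
    (h : evalAt φ E (𝟙 E.obj) = evalAt ψ E (𝟙 E.obj)) : φ = ψ :=
  compactYoneda_hom_ext fun _ q ↦
    (evalAt_eq_map φ (ObjectProperty.homMk q)).trans
      ((congrArg _ h).trans (evalAt_eq_map ψ (ObjectProperty.homMk q)).symm)

variable [HasZeroObject C] [HasShift C ℤ] [∀ n : ℤ, (shiftFunctor C n).Additive]
  [Pretriangulated C]

variable (k) in
lemma isCohomological_compactYoneda (L : C) : IsCohomological k ((compactYoneda k).obj L) where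
  additive := inferInstanceAs (((compacts C).ι.op ⋙ (linearYoneda k C).obj L).Additive)
  map_smul r f := by
    ext (x : _ ⟶ L)
    exact Linear.smul_comp _ _ _ r f.hom x
  exact {_ _ Z} f g h hT y := by
    refine ⟨fun hy ↦ ?_, ?_⟩
    · obtain ⟨z, hz⟩ := Triangle.yoneda_exact₂ _ hT y hy
      exact ⟨z, hz.symm⟩
    · rintro ⟨z : Z.obj ⟶ L, rfl⟩
      change f.hom ≫ g.hom ≫ z = 0
      have : f.hom ≫ g.hom = 0 := comp_distTriang_mor_zero₁₂ _ hT
      rw [← Category.assoc, this, zero_comp]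

section IsCohomological

variable (hH : IsCohomological k H)

/-- The natural transformation `Hom(-, E) ⟶ H` attached by the Yoneda lemma to an element of
`H(E)`, for a compact object `E`. -/
def yonedaDesc (x : H.obj (op E)) : (compactYoneda k).obj E.obj ⟶ H where
  app Q := ModuleCat.ofHom
    { toFun q := H.map (ObjectProperty.homMk q : Q.unop ⟶ E).op x
      map_add' q q' := by
        have := hH.additive
        exact ConcreteCategory.congr_hom (H.map_add
          (f := (ObjectProperty.homMk q : Q.unop ⟶ E).op)
          (g := (ObjectProperty.homMk q' : Q.unop ⟶ E).op)) x
      map_smul' r q := ConcreteCategory.congr_hom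
        (hH.map_smul r (ObjectProperty.homMk q : Q.unop ⟶ E)) x }
  naturality Q Q' f := by
    ext q
    exact ConcreteCategory.congr_hom
      (H.map_comp (ObjectProperty.homMk q : Q.unop ⟶ E).op f) x

@[simp]
lemma evalAt_yonedaDesc_id (x : H.obj (op E)) : evalAt (yonedaDesc hH x) E (𝟙 E.obj) = x :=
  ConcreteCategory.congr_hom (H.map_id (op E)) x

include hH in
lemma exists_map_comp_eq_of_distTriang {Z : (compacts C).FullSubcategory} {f : Q ⟶ E} {g : E ⟶ Z}
    {h : Z.obj ⟶ Q.obj⟦(1 : ℤ)⟧} (hT : Triangle.mk f.hom g.hom h ∈ distTriang C)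
    (φ : (compactYoneda k).obj E.obj ⟶ H) (hφ : evalAt φ Q f.hom = 0) :
    ∃ ψ : (compactYoneda k).obj Z.obj ⟶ H, (compactYoneda k).map g.hom ≫ ψ = φ := by
  obtain ⟨z, hz⟩ := (hH.exact f g h hT (evalAt φ E (𝟙 E.obj))).1
    ((evalAt_eq_map φ f).symm.trans hφ)
  refine ⟨yonedaDesc hH z, compactYoneda_hom_ext_of_compact ?_⟩
  rw [evalAt_map_comp, Category.id_comp, evalAt_eq_map, evalAt_yonedaDesc_id]
  exact hz

end IsCohomological

end CompactYoneda

section IsoLocus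

variable {C : Type u} [Category.{v} C] [Preadditive C] {k : Type w} [CommRing k]
  {H H' : (compacts C).FullSubcategoryᵒᵖ ⥤ ModuleCat.{v} k}

/-- The compact objects at which a natural transformation is bijective. -/
def isoLocus (θ : H ⟶ H') : ObjectProperty C :=
  fun Q ↦ ∃ hQ : compacts C Q, IsIso (θ.app (op ⟨Q, hQ⟩))

variable (θ : H ⟶ H')

instance : (isoLocus θ).IsStableUnderRetracts where
  of_retract {X Y} r := by
    rintro ⟨hY, h⟩
    have hX : compacts C X := (compacts C).prop_of_retract r hY
    let r' : Retract (⟨X, hX⟩ : (compacts C).FullSubcategory) ⟨Y, hY⟩ :=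
      ⟨ObjectProperty.homMk r.i, ObjectProperty.homMk r.r, by ext; simp⟩
    let ρ : RetractArrow (θ.app (op ⟨X, hX⟩)) (θ.app (op ⟨Y, hY⟩)) :=
      { i := Arrow.homMk (r'.op.map H).i (r'.op.map H').i
        r := Arrow.homMk (r'.op.map H).r (r'.op.map H').r
        retract := by ext1 <;> exact Retract.retract _ }
    exact ⟨hX, (MorphismProperty.isomorphisms _).of_retract ρ h⟩

variable [Linear k C] [HasZeroObject C] [HasShift C ℤ] [∀ n : ℤ, (shiftFunctor C n).Additive]
  [Pretriangulated C]

lemma IsCohomological.exact_of_distTriang (hH : IsCohomological k H) {T : Triangle C}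
    (hT : T ∈ distTriang C) (h₁ : compacts C T.obj₁) (h₂ : compacts C T.obj₂)
    (h₃ : compacts C T.obj₃) :
    let f : (⟨_, h₁⟩ : (compacts C).FullSubcategory) ⟶ ⟨_, h₂⟩ := ObjectProperty.homMk T.mor₁
    let g : (⟨_, h₂⟩ : (compacts C).FullSubcategory) ⟶ ⟨_, h₃⟩ := ObjectProperty.homMk T.mor₂
    Function.Exact (H.map g.op).hom (H.map f.op).hom :=
  hH.exact _ _ T.mor₃ hT

variable {θ} (hH : IsCohomological k H) (hH' : IsCohomological k H')
include hH hH'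

lemma isoLocus_of_isZero {Z : C} (hZ : IsZero Z) : isoLocus θ Z := by
  have := hH.additive
  have := hH'.additive
  have hc : compacts C Z := (compacts C).prop_of_isZero hZ
  have hZ' : IsZero (⟨Z, hc⟩ : (compacts C).FullSubcategory) :=
    (IsZero.iff_id_eq_zero _).2 (by ext; exact hZ.eq_of_src _ _)
  exact ⟨hc, (H.map_isZero hZ'.op).isIso (H'.map_isZero hZ'.op) _⟩

lemma isoLocus_obj₂ {T : Triangle C} (hT : T ∈ distTriang C) (h₁ : isoLocus θ T.obj₁)
    (h₁' : isoLocus θ (T.obj₁⟦(1 : ℤ)⟧)) (h₃ : isoLocus θ T.obj₃)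
    (h₃' : isoLocus θ (T.obj₃⟦(-1 : ℤ)⟧)) : isoLocus θ T.obj₂ := by
  have bijective {Q : C} (h : isoLocus θ Q) : Function.Bijective (θ.app (op ⟨Q, h.1⟩)).hom :=
    (ConcreteCategory.isIso_iff_bijective _).1 h.2
  have naturality {Q Q' : (compacts C).FullSubcategory} (f : Q ⟶ Q') :
      (H'.map f.op).hom.comp (θ.app (op Q')).hom = (θ.app (op Q)).hom.comp (H.map f.op).hom := by
    rw [← ModuleCat.hom_comp, ← ModuleCat.hom_comp, θ.naturality]
  have h₂ := (compacts C).ext_of_isTriangulatedClosed₂ T hT h₁.1 h₃.1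
  refine ⟨h₂, (ConcreteCategory.isIso_iff_bijective _).2 ?_⟩
  exact LinearMap.bijective_of_surjective_of_bijective_of_bijective_of_injective _ _ _ _ _ _ _ _
    (θ.app (op ⟨_, h₁'.1⟩)).hom (θ.app (op ⟨_, h₃.1⟩)).hom (θ.app (op ⟨_, h₂⟩)).hom
    (θ.app (op ⟨_, h₁.1⟩)).hom (θ.app (op ⟨_, h₃'.1⟩)).hom
    (naturality _) (naturality _) (naturality _) (naturality _)
    (hH.exact_of_distTriang (rot_of_distTriang _ hT) h₂ h₃.1 h₁'.1)
    (hH.exact_of_distTriang hT h₁.1 h₂ h₃.1)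
    (hH.exact_of_distTriang (inv_rot_of_distTriang _ hT) h₃'.1 h₁.1 h₂)
    (hH'.exact_of_distTriang (rot_of_distTriang _ hT) h₂ h₃.1 h₁'.1)
    (hH'.exact_of_distTriang hT h₁.1 h₂ h₃.1)
    (hH'.exact_of_distTriang (inv_rot_of_distTriang _ hT) h₃'.1 h₁.1 h₂)
    (bijective h₁').2 (bijective h₃) (bijective h₁) (bijective h₃').1

lemma isIso_of_generates {G : ℤ → ObjectProperty C} (hG : smallGen G Set.univ = compacts C)
    (hθ : ∀ m Q, G m Q → ∀ n : ℤ, isoLocus θ (Q⟦n⟧)) : IsIso θ := by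
  let P : ObjectProperty C := fun Q ↦ ∀ n : ℤ, isoLocus θ (Q⟦n⟧)
  have : P.IsStableUnderRetracts := ⟨fun r h n ↦
    (isoLocus θ).prop_of_retract (r.map (shiftFunctor C n)) (h n)⟩
  have : P.ContainsZero := ⟨_, isZero_zero C, fun n ↦
    isoLocus_of_isZero hH hH' ((shiftFunctor C n).map_isZero (isZero_zero C))⟩
  have shift_shift {Q : C} (h : P Q) (n m : ℤ) : isoLocus θ (Q⟦n⟧⟦m⟧) :=
    (isoLocus θ).prop_of_iso ((shiftFunctorAdd C n m).app Q) (h (n + m))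
  have : P.IsTriangulatedClosed₂ := .mk' fun T hT h₁ h₃ n ↦
    isoLocus_obj₂ hH hH' (Triangle.shift_distinguished T hT n) (h₁ n) (shift_shift h₁ n 1) (h₃ n)
      (shift_shift h₃ n (-1))
  have le : compacts C ≤ P := hG ▸ smallGen_le fun m _ ↦ hθ m
  have (Q : (compacts C).FullSubcategoryᵒᵖ) : IsIso (θ.app Q) :=
    ((isoLocus θ).prop_of_iso ((shiftFunctorZero C ℤ).app _) (le _ Q.unop.2 0)).2
  exact NatIso.isIso_of_isIso_app θ

end IsoLocus

section CompactYonedaColimit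

variable {C : Type u} [Category.{v} C] [Preadditive C] [HasZeroObject C] [HasShift C ℤ]
  [∀ n : ℤ, (shiftFunctor C n).Additive] [Pretriangulated C] {k : Type w} [CommRing k] [Linear k C]
  {X : ℕ ⥤ C} [HasCoproduct X.obj] {c : Cocone X}

instance : PreservesColimitsOfShape ℕ (forget (ModuleCat.{v} k)) := by
  have : PreservesFilteredColimitsOfSize.{0, 0} (forget AddCommGrpCat.{v}) :=
    preservesFilteredColimitsOfSize_shrink _
  have := ModuleCat.forget₂PreservesColimitsOfShape (J := ℕ) (R := k)
  exact inferInstanceAs (PreservesColimitsOfShape ℕ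
    (forget₂ (ModuleCat.{v} k) AddCommGrpCat.{v} ⋙ forget AddCommGrpCat.{v}))

lemma IsHomotopyColimit.isColimit_compactYoneda (hc : IsHomotopyColimit c) :
    Nonempty (IsColimit ((compactYoneda k).mapCocone c)) := by
  refine ⟨evaluationJointlyReflectsColimits _ fun Q ↦ ?_⟩
  have := reflectsColimitsOfShape_of_reflectsIsomorphisms (J := ℕ) (G := forget (ModuleCat.{v} k))
  refine isColimitOfReflects (forget (ModuleCat.{v} k)) ?_
  refine Types.FilteredColimit.isColimitOf' _ _ ?_ ?_
  · intro (q : Q.unop.obj ⟶ c.pt)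
    obtain ⟨j, y, hy⟩ := hc.exists_lift Q.unop.2 q
    exact ⟨j, y, hy.symm⟩
  · intro j (x : Q.unop.obj ⟶ X.obj j) (y : Q.unop.obj ⟶ X.obj j)
      (h : x ≫ c.ι.app j = y ≫ c.ι.app j)
    obtain ⟨n, hn, e⟩ := hc.exists_eq_zero Q.unop.2 (y := x - y) (by
      rw [Preadditive.sub_comp, h, sub_self])
    rw [Preadditive.sub_comp, sub_eq_zero] at e
    exact ⟨n, homOfLE hn, e⟩

end CompactYonedaColimit

section Finite

variable {D : Type*} [Category* D]

lemma exists_hom_forall_of_finite {ι : Type*} {s : Set ι} (hs : s.Finite) {a : D}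
    {P : ι → ∀ ⦃b : D⦄, (a ⟶ b) → Prop}
    (exists_comp : ∀ i ∈ s, ∀ ⦃b⦄ (f : a ⟶ b), ∃ (c : D) (g : b ⟶ c), P i (f ≫ g))
    (comp : ∀ i ∈ s, ∀ ⦃b c⦄ (f : a ⟶ b) (g : b ⟶ c), P i f → P i (f ≫ g)) :
    ∃ (b : D) (f : a ⟶ b), ∀ i ∈ s, P i f := by
  induction s, hs using Set.Finite.induction_on with
  | empty => exact ⟨a, 𝟙 a, by simp⟩
  | @insert i s _ _ ih =>
    rw [Set.forall_mem_insert] at exists_comp comp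
    obtain ⟨b, f, hf⟩ := ih exists_comp.2 comp.2
    obtain ⟨c, g, hg⟩ := exists_comp.1 f
    exact ⟨c, f ≫ g, Set.forall_mem_insert.2 ⟨hg, fun j hj ↦ comp.2 j hj f g (hf j hj)⟩⟩

end Finite

section Resolution

variable {C : Type u} [Category.{v} C] [Preadditive C] {k : Type w} [CommRing k] [Linear k C]

/-- The category of compact objects `E` equipped with a natural transformation
`Hom(-, E) ⟶ H`, that is, with an element of `H(E)`. -/
abbrev CompactOver (H : (compacts C).FullSubcategoryᵒᵖ ⥤ ModuleCat.{v} k) :=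
  CostructuredArrow ((compacts C).ι ⋙ compactYoneda k) H

variable {H : (compacts C).FullSubcategoryᵒᵖ ⥤ ModuleCat.{v} k} {a b c : CompactOver H}
  {Q : (compacts C).FullSubcategory}

lemma evalAt_hom_comp_left (f : a ⟶ b) (q : Q.obj ⟶ a.left.obj) :
    evalAt b.hom Q (q ≫ f.left.hom) = evalAt a.hom Q q :=
  (evalAt_map_comp f.left.hom b.hom q).symm.trans
    (congrArg (fun φ ↦ evalAt φ Q q) (CostructuredArrow.w f))

/-- A morphism `a ⟶ b` over `H` resolves `Q` if all the elements of `H(Q)` lift to `Hom(Q, b)`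
and the elements of `Hom(Q, a)` which vanish in `H(Q)` already vanish in `Hom(Q, b)`. The colimit
of a sequence of morphisms resolving `Q` computes `H(Q)`. -/
structure Resolves (f : a ⟶ b) (Q : (compacts C).FullSubcategory) : Prop where
  surjective : Function.Surjective (evalAt b.hom Q)
  eq_zero (q : Q.obj ⟶ a.left.obj) (hq : evalAt a.hom Q q = 0) : q ≫ f.left.hom = 0

lemma surjective_evalAt_of_hom (g : b ⟶ c) (h : Function.Surjective (evalAt b.hom Q)) :
    Function.Surjective (evalAt c.hom Q) := by
  intro x
  obtain ⟨q, rfl⟩ := h x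
  exact ⟨q ≫ g.left.hom, evalAt_hom_comp_left g q⟩

lemma Resolves.precomp {g : b ⟶ c} (h : Resolves g Q) (f : a ⟶ b) : Resolves (f ≫ g) Q where
  surjective := h.surjective
  eq_zero q hq := (Category.assoc _ _ _).symm.trans
    (h.eq_zero (q ≫ f.left.hom) ((evalAt_hom_comp_left f q).trans hq))

lemma Resolves.postcomp {f : a ⟶ b} (h : Resolves f Q) (g : b ⟶ c) : Resolves (f ≫ g) Q where
  surjective := surjective_evalAt_of_hom g h.surjective
  eq_zero q hq := (reassoc_of% h.eq_zero q hq) g.left.hom |>.trans zero_comp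

variable [HasZeroObject C] [HasShift C ℤ] [∀ n : ℤ, (shiftFunctor C n).Additive]
  [Pretriangulated C] (hH : IsCohomological k H)
include hH

lemma exists_hom_mem_range_evalAt (a : CompactOver H) (x : H.obj (op Q)) :
    ∃ (b : CompactOver H) (_ : a ⟶ b), x ∈ (evalAt b.hom Q).range := by
  let E : (compacts C).FullSubcategory := ⟨a.left.obj ⊞ Q.obj,
    (compacts C).ext_of_isTriangulatedClosed₂ _ (binaryBiproductTriangle_distinguished _ _)
      a.left.2 Q.2⟩
  let φ : (compactYoneda k).obj E.obj ⟶ H :=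
    (compactYoneda k).map biprod.fst ≫ a.hom + (compactYoneda k).map biprod.snd ≫ yonedaDesc hH x
  have hφ {Q' : (compacts C).FullSubcategory} (q : Q'.obj ⟶ a.left.obj ⊞ Q.obj) :
      evalAt φ Q' q = evalAt a.hom Q' (q ≫ biprod.fst) +
        evalAt (yonedaDesc hH x) Q' (q ≫ biprod.snd) := rfl
  refine ⟨.mk (S := (compacts C).ι ⋙ compactYoneda k) (Y := E) φ,
    CostructuredArrow.homMk (ObjectProperty.homMk biprod.inl) ?_, biprod.inr, ?_⟩
  · refine compactYoneda_hom_ext fun Q' q ↦ (hφ (q ≫ biprod.inl)).trans ?_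
    simp
  · exact (hφ biprod.inr).trans (by simp)

lemma exists_hom_surjective_evalAt [Module.Finite k (H.obj (op Q))] (a : CompactOver H) :
    ∃ (b : CompactOver H) (_ : a ⟶ b), Function.Surjective (evalAt b.hom Q) := by
  obtain ⟨s, hs, hspan⟩ := Submodule.fg_def.1 (Module.Finite.fg_top (R := k) (M := H.obj (op Q)))
  obtain ⟨b, f, hb⟩ := exists_hom_forall_of_finite hs (a := a)
    (P := fun x b _ ↦ x ∈ (evalAt b.hom Q).range)
    (fun x _ b _ ↦ exists_hom_mem_range_evalAt hH b x)
    (fun x _ b c _ g ⟨q, hq⟩ ↦ ⟨q ≫ g.left.hom, (evalAt_hom_comp_left g q).trans hq⟩)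
  exact ⟨b, f, LinearMap.range_eq_top.1 (top_le_iff.1 (hspan ▸ Submodule.span_le.2 hb))⟩

lemma exists_hom_comp_eq_zero (a : CompactOver H) (q : Q.obj ⟶ a.left.obj)
    (hq : evalAt a.hom Q q = 0) :
    ∃ (b : CompactOver H) (f : a ⟶ b), q ≫ f.left.hom = 0 := by
  obtain ⟨Z, g, h, hT⟩ := distinguished_cocone_triangle q
  let Z' : (compacts C).FullSubcategory :=
    ⟨Z, (compacts C).ext_of_isTriangulatedClosed₃ _ hT Q.2 a.left.2⟩
  obtain ⟨ψ, hψ⟩ := exists_map_comp_eq_of_distTriang (Z := Z') hH (f := ObjectProperty.homMk q)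
    (g := ObjectProperty.homMk g) hT a.hom hq
  exact ⟨.mk (S := (compacts C).ι ⋙ compactYoneda k) (Y := Z') ψ,
    CostructuredArrow.homMk (ObjectProperty.homMk g) hψ, comp_distTriang_mor_zero₁₂ _ hT⟩

lemma exists_hom_resolves [Module.Finite k (H.obj (op Q))]
    (hhom : ∀ E : (compacts C).FullSubcategory, IsNoetherian k (Q.obj ⟶ E.obj))
    (a : CompactOver H) :
    ∃ (b : CompactOver H) (f : a ⟶ b), Resolves f Q := by
  obtain ⟨b, f, hb⟩ := exists_hom_surjective_evalAt hH (Q := Q) a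
  obtain ⟨s, hs, hspan⟩ := Submodule.fg_def.1
    ((hhom b.left).noetherian (evalAt b.hom Q).ker)
  obtain ⟨c, g, hg⟩ := exists_hom_forall_of_finite hs (a := b)
    (P := fun q c (g : b ⟶ c) ↦ q ≫ g.left.hom = 0)
    (fun q hqs c g ↦ by
      have hq : evalAt b.hom Q q = 0 := hspan.le (Submodule.subset_span hqs)
      obtain ⟨d, h, hd⟩ := exists_hom_comp_eq_zero hH c (q ≫ g.left.hom)
        ((evalAt_hom_comp_left g q).trans hq)
      exact ⟨d, h, (Category.assoc _ _ _).symm.trans hd⟩)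
    (fun q _ c d g h hq ↦ ((reassoc_of% hq) h.left.hom).trans zero_comp)
  refine ⟨c, f ≫ g, Resolves.precomp ⟨surjective_evalAt_of_hom g hb, fun q hq ↦ ?_⟩ f⟩
  have : (evalAt b.hom Q).ker ≤ (Linear.rightComp k Q.obj g.left.hom).ker :=
    hspan ▸ Submodule.span_le.2 hg
  exact this hq

lemma exists_hom_forall_resolves {U : Set (compacts C).FullSubcategory} (hU : U.Finite)
    (hHfin : ∀ Q, Module.Finite k (H.obj (op Q)))
    (hhom : ∀ Q E : (compacts C).FullSubcategory, IsNoetherian k (Q.obj ⟶ E.obj))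
    (a : CompactOver H) : ∃ (b : CompactOver H) (f : a ⟶ b), ∀ Q ∈ U, Resolves f Q :=
  exists_hom_forall_of_finite hU
    (fun Q _ b f ↦
      have := hHfin Q
      have ⟨c, g, hg⟩ := exists_hom_resolves hH (hhom _) b
      ⟨c, g, hg.precomp f⟩)
    (fun _ _ _ _ _ g h ↦ h.postcomp g)

lemma exists_sequence_resolves {U : ℕ → Set (compacts C).FullSubcategory}
    (hU : ∀ j, (U j).Finite) (hHfin : ∀ Q, Module.Finite k (H.obj (op Q)))
    (hhom : ∀ Q E : (compacts C).FullSubcategory, IsNoetherian k (Q.obj ⟶ E.obj))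
    {P : ObjectProperty C}
    (hP : ∀ a : CompactOver H, ∃ (b : CompactOver H) (_ : a ⟶ b), P b.left.obj) :
    ∃ X : ℕ ⥤ CompactOver H, (∀ j, P (X.obj j).left.obj) ∧
      ∀ j, ∀ Q ∈ U j, Resolves (X.map (homOfLE j.le_succ)) Q := by
  have step (j : ℕ) (a : CompactOver H) : ∃ (b : CompactOver H) (f : a ⟶ b), P b.left.obj ∧
      ∀ Q ∈ U j, Resolves f Q := by
    obtain ⟨b, f, hf⟩ := exists_hom_forall_resolves hH (hU j) hHfin hhom a
    obtain ⟨c, g, hc⟩ := hP b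
    exact ⟨c, f ≫ g, hc, fun Q hQ ↦ (hf Q hQ).postcomp g⟩
  choose next f hnext hf using step
  obtain ⟨a₀, -, ha₀⟩ := hP (.mk (S := (compacts C).ι ⋙ compactYoneda k)
    (Y := ⟨_, (compacts C).prop_of_isZero (isZero_zero C)⟩) 0)
  let a : ℕ → CompactOver H := fun n ↦ Nat.rec a₀ next n
  refine ⟨Functor.ofSequence (X := a) fun j ↦ f j (a j), fun j ↦ ?_, fun j Q hQ ↦ ?_⟩
  · cases j with
    | zero => exact ha₀
    | succ j => exact hnext j (a j)
  · rw [Functor.ofSequence_map_homOfLE_succ]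
    exact hf j (a j) Q hQ

end Resolution

section ShiftedUnion

variable {C : Type u} [Category.{v} C] [Preadditive C] [HasShift C ℤ]

/-- The compact objects `Z⟦t⟧` with `Z ∈ G n` and `|n|, |t| ≤ j`. -/
def shiftedUnion (G : ℤ → ObjectProperty C) (j : ℕ) : Set (compacts C).FullSubcategory :=
  {Q | ∃ n ∈ Finset.Icc (-j : ℤ) j, ∃ t ∈ Finset.Icc (-j : ℤ) j,
    ∃ Z, G n Z ∧ Z⟦t⟧ = Q.obj}

lemma finite_shiftedUnion {G : ℤ → ObjectProperty C} (hG : ∀ n, {X : C | G n X}.Finite) (j : ℕ) :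
    (shiftedUnion G j).Finite := by
  have hfin : (⋃ n ∈ Finset.Icc (-j : ℤ) j, ⋃ t ∈ Finset.Icc (-j : ℤ) j,
      (fun Z : C ↦ Z⟦t⟧) '' {Z | G n Z}).Finite :=
    (Finset.finite_toSet _).biUnion fun n _ ↦
      (Finset.finite_toSet _).biUnion fun t _ ↦ (hG n).image _
  refine (hfin.preimage fun _ _ _ _ h ↦ ObjectProperty.FullSubcategory.ext h).subset ?_
  rintro Q ⟨n, hn, t, ht, Z, hZ, e⟩
  exact Set.mem_biUnion hn (Set.mem_biUnion ht ⟨Z, hZ, e⟩)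

end ShiftedUnion

section Realization

variable {C : Type u} [Category.{v} C] [Preadditive C] [HasZeroObject C] [HasShift C ℤ]
  [∀ n : ℤ, (shiftFunctor C n).Additive] [Pretriangulated C]
  {k : Type w} [CommRing k] [Linear k C]
  {H : (compacts C).FullSubcategoryᵒᵖ ⥤ ModuleCat.{v} k}

/-- The sequence of compact objects underlying a sequence of compact objects over `H`. -/
abbrev underlyingSequence (X : ℕ ⥤ CompactOver H) : ℕ ⥤ C :=
  X ⋙ CostructuredArrow.proj _ _ ⋙ (compacts C).ι

variable {X : ℕ ⥤ CompactOver H} [HasCoproduct (underlyingSequence X).obj]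
  {c : Cocone (underlyingSequence X)}

lemma IsHomotopyColimit.exists_hom (hc : IsHomotopyColimit c) :
    ∃ θ : (compactYoneda k).obj c.pt ⟶ H,
      ∀ j, (compactYoneda k).map (c.ι.app j) ≫ θ = (X.obj j).hom := by
  obtain ⟨h⟩ := hc.isColimit_compactYoneda (k := k)
  let s : Cocone (underlyingSequence X ⋙ compactYoneda k) :=
    { pt := H
      ι := { app := fun j ↦ (X.obj j).hom
             naturality := fun _ _ f ↦ (CostructuredArrow.w (X.map f)).trans
              (Category.comp_id _).symm } }
  exact ⟨h.desc s, h.fac s⟩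

lemma IsHomotopyColimit.isIso_app (hc : IsHomotopyColimit c)
    {θ : (compactYoneda k).obj c.pt ⟶ H}
    (hθ : ∀ j, (compactYoneda k).map (c.ι.app j) ≫ θ = (X.obj j).hom)
    {Q : (compacts C).FullSubcategory}
    (hQ : ∃ N, ∀ j, N ≤ j → Resolves (X.map (homOfLE (Nat.le_succ j))) Q) :
    IsIso (θ.app (op Q)) := by
  obtain ⟨N, hN⟩ := hQ
  have evalAt_hom (j : ℕ) (q : Q.obj ⟶ (X.obj j).left.obj) :
      evalAt (X.obj j).hom Q q = evalAt θ Q (q ≫ c.ι.app j) := by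
    rw [← hθ]
    rfl
  refine (ConcreteCategory.isIso_iff_bijective _).2
    ⟨(injective_iff_map_eq_zero (evalAt θ Q)).2 fun q hq ↦ ?_, fun x ↦ ?_⟩
  · obtain ⟨j, y, rfl⟩ := hc.exists_lift Q.2 q
    let n := max j N
    let y' : Q.obj ⟶ (X.obj n).left.obj :=
      y ≫ (underlyingSequence X).map (homOfLE (le_max_left j N))
    have hy' : y' ≫ c.ι.app n = y ≫ c.ι.app j :=
      (Category.assoc _ _ _).trans (congrArg (y ≫ ·) (c.w _))
    have hy₀ : y' ≫ (underlyingSequence X).map (homOfLE n.le_succ) = 0 :=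
      (hN n (le_max_right j N)).eq_zero y' ((evalAt_hom n y').trans (hy' ▸ hq))
    rw [← hy', ← c.w (homOfLE n.le_succ)]
    exact (Category.assoc _ _ _).symm.trans ((congrArg (· ≫ c.ι.app _) hy₀).trans zero_comp)
  · obtain ⟨q, hq⟩ := (hN N le_rfl).surjective x
    exact ⟨q ≫ c.ι.app (N + 1), (evalAt_hom (N + 1) q).symm.trans hq⟩

lemma exists_isHomotopyColimit_iso [HasColimitsOfShape (Discrete ℕ) C]
    {G : ℤ → ObjectProperty C} (hG : IsFiniteGeneratingSequence G) (hH : IsCohomological k H)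
    (hHfin : ∀ Q, Module.Finite k (H.obj (op Q)))
    (hhom : ∀ Q E : (compacts C).FullSubcategory, IsNoetherian k (Q.obj ⟶ E.obj))
    {P : ObjectProperty C}
    (hP : ∀ a : CompactOver H, ∃ (b : CompactOver H) (_ : a ⟶ b), P b.left.obj) :
    ∃ (X : ℕ ⥤ C) (c : Cocone X), (∀ j, (compacts C ⊓ P) (X.obj j)) ∧ IsHomotopyColimit c ∧
      Nonempty ((compactYoneda k).obj c.pt ≅ H) := by
  obtain ⟨X, hX, hres⟩ :=
    exists_sequence_resolves hH (finite_shiftedUnion hG.finite) hHfin hhom hP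
  obtain ⟨c, hc⟩ := exists_isHomotopyColimit (underlyingSequence X)
  obtain ⟨θ, hθ⟩ := hc.exists_hom
  have : IsIso θ := by
    refine isIso_of_generates (isCohomological_compactYoneda k c.pt) hH hG.generates
      fun m Z hZ t ↦ ⟨(compacts C).le_shift t Z (hG.le_compacts m Z hZ), ?_⟩
    refine hc.isIso_app hθ ⟨m.natAbs + t.natAbs, fun j hj ↦ hres j _ ⟨m, ?_, t, ?_, Z, hZ, rfl⟩⟩
    all_goals rw [Finset.mem_Icc]; lia
  exact ⟨_, c, fun j ↦ ⟨(X.obj j).left.2, hX j⟩, hc, ⟨asIso θ⟩⟩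

lemma IsHomotopyColimit.compactYoneda_map_surjective {X : ℕ ⥤ C} [HasCoproduct X.obj]
    {c : Cocone X} (hc : IsHomotopyColimit c) (hX : ∀ j, compacts C (X.obj j)) (F : C) :
    Function.Surjective ((compactYoneda k).map : (c.pt ⟶ F) → _) := by
  intro η
  let E (j : ℕ) : (compacts C).FullSubcategory := ⟨X.obj j, hX j⟩
  let c' : Cocone X :=
    { pt := F
      ι := { app := fun j ↦ evalAt η (E j) (c.ι.app j)
             naturality := fun i j f ↦ by
              have h := evalAt_comp η (ObjectProperty.homMk (X.map f) : E i ⟶ E j) (c.ι.app j)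
              exact h.symm.trans ((congrArg _ (c.w f)).trans (Category.comp_id _).symm) } }
  obtain ⟨f, hf⟩ := hc.exists_desc c'
  refine ⟨f, compactYoneda_hom_ext fun Q q ↦ ?_⟩
  obtain ⟨j, y, rfl⟩ := hc.exists_lift Q.2 q
  have h := evalAt_comp η (ObjectProperty.homMk y : Q ⟶ E j) (c.ι.app j)
  exact (Category.assoc _ _ _).trans ((congrArg (y ≫ ·) (hf j)).trans h.symm)

lemma isIso_of_isIso_compactYoneda_map (hC : IsCompactlyGenerated C) {L F : C} (f : L ⟶ F)
    [IsIso ((compactYoneda k).map f)] : IsIso f := by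
  have bijective {Q : C} (hQ : compacts C Q) : Function.Bijective fun q : Q ⟶ L ↦ q ≫ f :=
    (ConcreteCategory.isIso_iff_bijective
      (((compactYoneda k).map f).app (op ⟨Q, hQ⟩))).1 inferInstance
  obtain ⟨Z, g, h, hT⟩ := distinguished_cocone_triangle₁ f
  have hgf : g ≫ f = 0 := comp_distTriang_mor_zero₁₂ _ hT
  have hfh : f ≫ h = 0 := comp_distTriang_mor_zero₂₃ _ hT
  obtain ⟨S, -, hS, hZ⟩ := hC
  refine (Triangle.isZero₁_iff_isIso₂ _ hT).1 (hZ Z fun X hX n q ↦ ?_)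
  have hQ := (compacts C).le_shift n X (hS X hX)
  have hqg : q ≫ g = 0 := (bijective hQ).1 (by simp [hgf])
  obtain ⟨y : X⟦n⟧⟦(1 : ℤ)⟧ ⟶ F, hy : q⟦(1 : ℤ)⟧' = y ≫ h⟩ :=
    Triangle.coyoneda_exact₁ _ hT (q⟦(1 : ℤ)⟧')
      (((shiftFunctor C (1 : ℤ)).map_comp q g).symm.trans
        ((congrArg _ hqg).trans ((shiftFunctor C (1 : ℤ)).map_zero _ _)))
  obtain ⟨p, rfl⟩ := (bijective ((compacts C).le_shift 1 _ hQ)).2 y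
  exact (shiftFunctor C (1 : ℤ)).map_injective (by simp [hy, hfh])

end Realization

section HomFinite

variable {C : Type u} [Category.{v} C] [Preadditive C] (k : Type w) [CommRing k] [Linear k C]

/-- The objects `F` such that `Hom(X, F)` is a finitely generated module for all compact `X`. -/
def HomFinite : ObjectProperty C :=
  fun F ↦ ∀ X : C, compacts C X → Module.Finite k (X ⟶ F)

instance : (HomFinite k : ObjectProperty C).IsStableUnderRetracts where
  of_retract r hY Q hQ := by
    have := hY Q hQ
    exact Module.Finite.of_surjective (Linear.rightComp k Q r.r) fun q ↦ ⟨q ≫ r.i, by simp⟩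

variable [HasZeroObject C]

open ZeroObject in
instance : (HomFinite k : ObjectProperty C).ContainsZero where
  exists_zero := ⟨_, isZero_zero C, fun Q _ ↦ by
    have : Subsingleton (Q ⟶ (0 : C)) := ⟨fun _ _ ↦ (isZero_zero C).eq_of_tgt _ _⟩
    infer_instance⟩

variable [HasShift C ℤ] [∀ n : ℤ, (shiftFunctor C n).Additive] [Pretriangulated C]

instance [∀ n : ℤ, (shiftFunctor C n).Linear k] :
    (HomFinite k : ObjectProperty C).IsStableUnderShift ℤ where
  isStableUnderShiftBy n := ⟨fun X hX Q hQ ↦ by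
    have := hX (Q⟦-n⟧) ((compacts C).le_shift (-n) Q hQ)
    refine Module.Finite.of_surjective
      ((Linear.leftComp k (X⟦n⟧) (shiftNegShift Q n).inv).comp
        ((shiftFunctor C n).mapLinearMap k (X := Q⟦-n⟧) (Y := X))) fun q ↦
      ⟨(shiftFunctor C n).preimage ((shiftNegShift Q n).hom ≫ q), ?_⟩
    change (shiftNegShift Q n).inv ≫ (shiftFunctor C n).map ((shiftFunctor C n).preimage _) = q
    simp⟩

variable [IsNoetherianRing k]

lemma finite_hom_obj₂ {T : Triangle C} (hT : T ∈ distTriang C) (Q : C)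
    [Module.Finite k (Q ⟶ T.obj₁)] [Module.Finite k (Q ⟶ T.obj₃)] :
    Module.Finite k (Q ⟶ T.obj₂) := by
  have := isNoetherian_of_range_eq_ker (Linear.rightComp k Q T.mor₁) (Linear.rightComp k Q T.mor₂)
    (le_antisymm
      (by rintro _ ⟨q, rfl⟩; simp [comp_distTriang_mor_zero₁₂ _ hT])
      fun q hq ↦ (Triangle.coyoneda_exact₂ T hT q hq).imp fun _ ↦ Eq.symm)
  infer_instance

lemma finite_obj₂_hom {T : Triangle C} (hT : T ∈ distTriang C) (Y : C)
    [Module.Finite k (T.obj₁ ⟶ Y)] [Module.Finite k (T.obj₃ ⟶ Y)] :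
    Module.Finite k (T.obj₂ ⟶ Y) := by
  have := isNoetherian_of_range_eq_ker (Linear.leftComp k Y T.mor₂) (Linear.leftComp k Y T.mor₁)
    (le_antisymm
      (by rintro _ ⟨q, rfl⟩; simp [comp_distTriang_mor_zero₁₂_assoc _ hT])
      fun q hq ↦ (Triangle.yoneda_exact₂ T hT q hq).imp fun _ ↦ Eq.symm)
  infer_instance

instance : (HomFinite k : ObjectProperty C).IsTriangulatedClosed₂ := .mk' fun _ hT h₁ h₃ Q hQ ↦
  have := h₁ Q hQ
  have := h₃ Q hQ
  finite_hom_obj₂ k hT Q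

/-- The objects `X` such that `Hom(X, Y)` is a finitely generated module. -/
def FiniteHomTo (Y : C) : ObjectProperty C :=
  fun X ↦ Module.Finite k (X ⟶ Y)

instance (Y : C) : (FiniteHomTo k Y).IsStableUnderRetracts where
  of_retract r (_ : Module.Finite k _) :=
    Module.Finite.of_surjective (Linear.leftComp k Y r.i) fun q ↦ ⟨r.r ≫ q, by simp⟩

open ZeroObject in
instance (Y : C) : (FiniteHomTo k Y).ContainsZero where
  exists_zero := ⟨_, isZero_zero C, by
    have : Subsingleton ((0 : C) ⟶ Y) := ⟨fun _ _ ↦ (isZero_zero C).eq_of_src _ _⟩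
    exact inferInstanceAs (Module.Finite k (_ ⟶ _))⟩

instance (Y : C) : (FiniteHomTo k Y).IsTriangulatedClosed₂ :=
  .mk' fun _ hT (_ : Module.Finite k _) (_ : Module.Finite k _) ↦ finite_obj₂_hom k hT Y

lemma compacts_le_homFinite {G : ℤ → ObjectProperty C} (hG : smallGen G Set.univ = compacts C)
    (hfin : ∀ (m n : ℤ) (X Y : C), G m X → G n Y → Module.Finite k (X ⟶ Y)) :
    compacts C ≤ HomFinite k := by
  conv_lhs => rw [← hG]
  refine smallGen_le fun n _ Y hY ↦ ?_
  have : compacts C ≤ FiniteHomTo k Y := hG ▸ smallGen_le fun m _ X hX ↦ hfin m n X Y hX hY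
  exact this

end HomFinite

section HomFiniteResolution

variable {C : Type u} [Category.{v} C] [Preadditive C] [HasZeroObject C] [HasShift C ℤ]
  [∀ n : ℤ, (shiftFunctor C n).Additive] [Pretriangulated C]
  {k : Type w} [CommRing k] [IsNoetherianRing k] [Linear k C] {F F' : C}

lemma exists_isHomotopyColimit_of_homFinite [HasColimitsOfShape (Discrete ℕ) C]
    (hC : IsCompactlyGenerated C) {G : ℤ → ObjectProperty C}
    (hG : IsFiniteGeneratingSequence G) (hhom : compacts C ≤ HomFinite k) (hF : HomFinite k F)
    {P : ObjectProperty C}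
    (hP : ∀ ⦃E : C⦄ (x : E ⟶ F), compacts C E →
      ∃ (E' : C) (x' : E' ⟶ F) (t : E ⟶ E'), t ≫ x' = x ∧ compacts C E' ∧ P E') :
    ∃ (X : ℕ ⥤ C) (c : Cocone X), (∀ j, (compacts C ⊓ P) (X.obj j)) ∧ IsHomotopyColimit c ∧
      Nonempty (c.pt ≅ F) := by
  obtain ⟨X, c, hX, hc, ⟨e⟩⟩ := exists_isHomotopyColimit_iso hG
    (isCohomological_compactYoneda k F) (fun Q ↦ hF Q.obj Q.2)
    (fun Q E ↦ have := hhom E.obj E.2 Q.obj Q.2; inferInstance) (P := P) fun a ↦ by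
      obtain ⟨E, x, t, ht, hE, hPE⟩ := hP (evalAt a.hom a.left (𝟙 a.left.obj)) a.left.2
      let E' : (compacts C).FullSubcategory := ⟨E, hE⟩
      refine ⟨.mk (S := (compacts C).ι ⋙ compactYoneda k) (Y := E') ((compactYoneda k).map x),
        CostructuredArrow.homMk (ObjectProperty.homMk t) ?_, hPE⟩
      exact compactYoneda_hom_ext_of_compact ((congrArg (· ≫ x) (Category.id_comp t)).trans ht)
  obtain ⟨f, hf⟩ := hc.compactYoneda_map_surjective (fun j ↦ (hX j).1) F e.hom
  have : IsIso ((compactYoneda k).map f) := hf ▸ inferInstance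
  have := isIso_of_isIso_compactYoneda_map (k := k) hC f
  exact ⟨X, c, hX, hc, ⟨asIso f⟩⟩

lemma compactYoneda_map_surjective_of_homFinite [HasColimitsOfShape (Discrete ℕ) C]
    (hC : IsCompactlyGenerated C) {G : ℤ → ObjectProperty C}
    (hG : IsFiniteGeneratingSequence G) (hhom : compacts C ≤ HomFinite k) (hF : HomFinite k F) :
    Function.Surjective ((compactYoneda k).map : (F ⟶ F') → _) := by
  obtain ⟨X, c, hX, hc, ⟨e⟩⟩ := exists_isHomotopyColimit_of_homFinite hC hG hhom hF (P := ⊤)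
    fun E x hE ↦ ⟨E, x, 𝟙 E, Category.id_comp x, hE, trivial⟩
  intro η
  obtain ⟨f, hf⟩ := hc.compactYoneda_map_surjective (fun j ↦ (hX j).1) F'
    ((compactYoneda k).map e.hom ≫ η)
  exact ⟨e.inv ≫ f, by rw [Functor.map_comp, hf, ← Functor.map_comp_assoc]; simp⟩

end HomFiniteResolution

section Orthogonal

variable {C : Type u} [Category.{v} C] [Preadditive C]

lemma antitone_leftOrthogonal :
    Antitone (ObjectProperty.leftOrthogonal : ObjectProperty C → ObjectProperty C) :=
  fun _ _ h _ hX _ f hY ↦ hX f (h _ hY)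

lemma antitone_rightOrthogonal :
    Antitone (ObjectProperty.rightOrthogonal : ObjectProperty C → ObjectProperty C) :=
  fun _ _ h _ hX _ f hY ↦ hX f (h _ hY)

lemma le_leftOrthogonal_rightOrthogonal (P : ObjectProperty C) :
    P ≤ P.rightOrthogonal.leftOrthogonal :=
  fun _ hX _ f hY ↦ hY f hX

instance (P : ObjectProperty C) : P.leftOrthogonal.IsStableUnderRetracts where
  of_retract r hY Z f hZ := by simpa using r.i ≫= hY (r.r ≫ f) hZ

lemma allSums_le_leftOrthogonal {U P : ObjectProperty C} (h : U ≤ P.leftOrthogonal) :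
    allSums U ≤ P.leftOrthogonal := by
  rintro X ⟨J, ⟨p⟩⟩ Y f hY
  exact p.isColimit.hom_ext fun j ↦ by rw [h _ (p.prop_diag_obj j) (_ ≫ f) hY, comp_zero]

variable [HasShift C ℤ] [∀ n : ℤ, (shiftFunctor C n).Additive]

lemma hom_shift_eq_zero_iff {X Y : C} (n : ℤ) :
    (∀ f : X⟦n⟧ ⟶ Y, f = 0) ↔ ∀ f : X ⟶ Y⟦-n⟧, f = 0 :=
  have : (shiftEquiv C n).functor.Additive := inferInstanceAs (shiftFunctor C n).Additive
  ((shiftEquiv C n).toAdjunction.homAddEquiv X Y).forall_congr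
    fun _ ↦ (AddEquiv.map_eq_zero_iff _).symm

lemma leftOrthogonal_rightOrthogonal_le_shift {P Q : ObjectProperty C} {n : ℤ}
    (h : P ≤ Q.shift n) :
    P.rightOrthogonal.leftOrthogonal ≤ Q.rightOrthogonal.leftOrthogonal.shift n :=
  fun _ hX _ f hY ↦ (hom_shift_eq_zero_iff n).2
    (fun g ↦ hX g fun _ a hZ ↦ (hom_shift_eq_zero_iff n).1 (fun b ↦ hY b (h _ hZ)) a) f

variable [HasZeroObject C] [Pretriangulated C]

lemma bigGen_le_leftOrthogonal {G : ℤ → ObjectProperty C} {s : Set ℤ} {P : ObjectProperty C}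
    (h : ∀ n ∈ s, G n ≤ P.leftOrthogonal) (m : ℕ) : bigGen G s m ≤ P.leftOrthogonal := by
  refine (ObjectProperty.retractClosure_le_iff _ _).2
    (ObjectProperty.extensionProductIter_le_of_isTriangulatedClosed₂ _
      (allSums_le_leftOrthogonal ?_) _)
  rintro Z ⟨n, hn, hZ⟩
  exact h n hn Z hZ

end Orthogonal

section ShiftedProperty

variable {C : Type u} [Category.{v} C] [HasShift C ℤ] (P : ObjectProperty C) (n : ℤ)

instance [P.IsStableUnderRetracts] : (P.shift n).IsStableUnderRetracts where
  of_retract r hY := P.prop_of_retract (r.map (shiftFunctor C n)) hY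

variable [Preadditive C] [HasZeroObject C] [∀ n : ℤ, (shiftFunctor C n).Additive]

instance [P.ContainsZero] [P.IsClosedUnderIsomorphisms] : (P.shift n).ContainsZero where
  exists_zero := ⟨_, isZero_zero C,
    P.prop_of_isZero ((shiftFunctor C n).map_isZero (isZero_zero C))⟩

instance [Pretriangulated C] [P.IsTriangulatedClosed₂] [P.IsClosedUnderIsomorphisms] :
    (P.shift n).IsTriangulatedClosed₂ := .mk' fun T hT h₁ h₃ ↦
  P.ext_of_isTriangulatedClosed₂ _ (Triangle.shift_distinguished T hT n) h₁ h₃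

end ShiftedProperty

section SmallGen

variable {C : Type u} [Category.{v} C] [Preadditive C] [HasZeroObject C] [HasShift C ℤ]
  [∀ n : ℤ, (shiftFunctor C n).Additive] [Pretriangulated C]
  (G : ℤ → ObjectProperty C)

instance (s : Set ℤ) : (smallGen G s).IsStableUnderRetracts :=
  inferInstanceAs (ObjectProperty.retractClosure _).IsStableUnderRetracts

open ZeroObject in
instance (s : Set ℤ) : (smallGen G s).ContainsZero where
  exists_zero := by
    let c : Cofan (fun i : Fin 0 ↦ (i.elim0 : C)) := Cofan.mk 0 fun i ↦ i.elim0
    have hc : IsColimit c := Cofan.IsColimit.mk _ (fun _ ↦ 0) (fun _ i ↦ i.elim0)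
      (fun _ _ _ ↦ (isZero_zero C).eq_of_src _ _)
    exact ⟨_, isZero_zero C, ObjectProperty.le_retractClosure _ _ (coprod.sum 0 _ c hc (nofun))⟩

instance (s : Set ℤ) : (smallGen G s).IsTriangulatedClosed₂ := .mk' fun T hT h₁ h₃ ↦ by
  obtain ⟨Y, ⟨A, B, f, g, h, hT', hA, hB⟩, ⟨r⟩⟩ :=
    ObjectProperty.extensionProduct_retractClosure_retractClosure_le (coprod (union G s))
      (coprod (union G s)) T.obj₂ ⟨_, _, _, _, _, hT, h₁, h₃⟩
  exact ⟨Y, coprod.ext _ hT' hA hB, ⟨r⟩⟩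

variable {G}

lemma le_smallGen {s : Set ℤ} {n : ℤ} (hn : n ∈ s) : G n ≤ smallGen G s :=
  fun X hX ↦ ObjectProperty.le_retractClosure _ _ (coprod.of_mem X ⟨n, hn, hX⟩)

variable (G) in
lemma monotone_smallGen : Monotone (smallGen G) :=
  fun _ _ h ↦ smallGen_le fun _ hn ↦ le_smallGen (h hn)

lemma smallGen_le_iSup {ι : Type*} [Nonempty ι] {P : ι → ObjectProperty C}
    (hP : Directed (· ≤ ·) P) [∀ i, (P i).ContainsZero] [∀ i, (P i).IsTriangulatedClosed₂]
    [∀ i, (P i).IsStableUnderRetracts] {s : Set ℤ} (hG : ∀ n ∈ s, ∃ i, G n ≤ P i) :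
    smallGen G s ≤ ⨆ i, P i := by
  have : (⨆ i, P i).ContainsZero :=
    ⟨_, isZero_zero C, le_iSup P (Classical.arbitrary ι) _ ((P _).prop_of_isZero (isZero_zero C))⟩
  have : (⨆ i, P i).IsTriangulatedClosed₂ := .mk' fun T hT h₁ h₃ ↦ by
    rw [ObjectProperty.prop_iSup_iff] at h₁ h₃ ⊢
    obtain ⟨⟨i, hi⟩, j, hj⟩ := And.intro h₁ h₃
    obtain ⟨l, hil, hjl⟩ := hP i j
    exact ⟨l, (P l).ext_of_isTriangulatedClosed₂ T hT (hil _ hi) (hjl _ hj)⟩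
  have : (⨆ i, P i).IsStableUnderRetracts := ⟨fun r hY ↦ by
    rw [ObjectProperty.prop_iSup_iff] at hY ⊢
    exact hY.imp fun i ↦ (P i).prop_of_retract r⟩
  exact smallGen_le fun n hn ↦ have ⟨i, hi⟩ := hG n hn; hi.trans (le_iSup P i)

lemma exists_le_of_forall_exists {ι : Type*} {P : ObjectProperty C} [P.ContainsZero]
    [P.IsClosedUnderIsomorphisms] [P.IsTriangulatedClosed₂] {Q : ι → ObjectProperty C}
    [∀ i, (Q i).IsStableUnderRetracts] {s : Finset ι} (h : ∀ X, P X → ∃ i ∈ s, Q i X) :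
    ∃ i ∈ s, P ≤ Q i := by
  classical
  contrapose! h
  induction s using Finset.induction_on with
  | empty => exact (P.exists_prop_of_containsZero).imp fun X hX ↦ ⟨hX.2, by simp⟩
  | insert i s _ ih =>
    rw [Finset.forall_mem_insert] at h
    obtain ⟨X, hX, hXs⟩ := ih h.2
    obtain ⟨Y, hY, hYi⟩ : ∃ Y, P Y ∧ ¬ Q i Y := by simpa [Pi.le_def] using h.1
    refine ⟨X ⊞ Y, P.ext_of_isTriangulatedClosed₂ _
      (binaryBiproductTriangle_distinguished X Y) hX hY, ?_⟩
    rw [Finset.forall_mem_insert]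
    exact ⟨fun hXY ↦ hYi ((Q i).prop_of_retract ⟨biprod.inr, biprod.snd, biprod.inr_snd⟩ hXY),
      fun j hj hXY ↦
        hXs j hj ((Q j).prop_of_retract ⟨biprod.inl, biprod.fst, biprod.inl_fst⟩ hXY)⟩

end SmallGen

section Metrics

variable {C : Type u} [Category.{v} C] [Preadditive C] [HasZeroObject C] [HasShift C ℤ]
  [∀ n : ℤ, (shiftFunctor C n).Additive] [Pretriangulated C] {G R : ℤ → ObjectProperty C}

instance (n : ℤ) : (metricM G n).IsStableUnderRetracts :=
  inferInstanceAs (smallGen G _).IsStableUnderRetracts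

instance (n : ℤ) : (metricM G n).ContainsZero :=
  inferInstanceAs (smallGen G _).ContainsZero

instance (n : ℤ) : (metricM G n).IsTriangulatedClosed₂ :=
  inferInstanceAs (smallGen G _).IsTriangulatedClosed₂

instance (n : ℤ) : (metricR G n).IsStableUnderRetracts :=
  inferInstanceAs (ObjectProperty.leftOrthogonal _).IsStableUnderRetracts

instance (n : ℤ) : (metricR G n).ContainsZero :=
  inferInstanceAs (ObjectProperty.leftOrthogonal _).ContainsZero

instance (n : ℤ) : (metricR G n).IsTriangulatedClosed₂ :=
  inferInstanceAs (ObjectProperty.leftOrthogonal _).IsTriangulatedClosed₂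

variable (G) in
lemma antitone_metricM : Antitone (metricM G) :=
  fun _ _ h ↦ monotone_smallGen G (Set.Iic_subset_Iic.2 (neg_le_neg h))

variable (G) in
lemma antitone_metricR : Antitone (metricR G) :=
  fun _ _ h ↦ antitone_leftOrthogonal (antitone_rightOrthogonal (antitone_metricM G h))

variable (G) in
lemma metricM_le_metricR (i : ℤ) : metricM G i ≤ metricR G i :=
  le_leftOrthogonal_rightOrthogonal _

lemma metricM_add_one_le_shift {t : ℤ}
    (hG : ∀ n X, G n X → smallGen G (Set.Icc (n - 1) (n + 1)) (X⟦t⟧)) (i : ℤ) :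
    metricM G (i + 1) ≤ (metricM G i).shift t :=
  smallGen_le fun n hn X hX ↦ monotone_smallGen G
    (Set.Icc_subset_Iic_self.trans (Set.Iic_subset_Iic.2 (by rw [Set.mem_Iic] at hn; lia)))
    _ (hG n X hX)

lemma metricR_add_one_le_shift_one (hG : IsGeneratingSequence G) (i : ℤ) :
    metricR G (i + 1) ≤ (metricR G i).shift (1 : ℤ) :=
  leftOrthogonal_rightOrthogonal_le_shift (metricM_add_one_le_shift hG.shift_pos i)

lemma metricR_add_one_le_shift_neg_one (hG : IsGeneratingSequence G) (i : ℤ) :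
    metricR G (i + 1) ≤ (metricR G i).shift (-1 : ℤ) :=
  leftOrthogonal_rightOrthogonal_le_shift (metricM_add_one_le_shift hG.shift_neg i)

lemma compacts_le_iSup_metricM (hG : IsGeneratingSequence G) :
    compacts C ≤ ⨆ i, metricM G i :=
  hG.generates ▸ smallGen_le_iSup (antitone_metricM G).directed_le
    fun n _ ↦ ⟨-n, le_smallGen (by simp)⟩

lemma exists_metricM_of_compacts (hG : IsGeneratingSequence G) {X : C} (hX : compacts C X) :
    ∃ b : ℤ, ∀ i ≤ b, metricM G i X :=
  ((ObjectProperty.prop_iSup_iff _ X).1 (compacts_le_iSup_metricM hG X hX)).imp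
    fun _ hb _ hi ↦ antitone_metricM G hi X hb

lemma IsExtendedGoodMetric.antitone (hR : IsExtendedGoodMetric R) : Antitone R :=
  antitone_int_of_succ_le hR.self

lemma IsOrthogonalMetric.isTriangulatedClosed₂ (hR : IsOrthogonalMetric R) (i : ℤ) :
    (R i).IsTriangulatedClosed₂ := by
  rw [← hR.orthogonal i]
  infer_instance

variable {A : ℕ}

lemma IsPreapproximableWith.metricR_le (h : IsPreapproximableWith G R A) {i j : ℤ}
    (hij : i + A ≤ j) : metricR G j ≤ R i := by
  rw [← h.metric.orthogonal i]
  exact (antitone_metricR G hij).trans (antitone_leftOrthogonal (antitone_rightOrthogonal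
    ((h.metricM_le i).trans inf_le_left)))

lemma IsQuasiapproximableWith.exists_leftOrthogonal (h : IsQuasiapproximableWith G R A)
    (hG : IsGeneratingSequence G) {X : C} (hX : compacts C X) :
    ∃ l : ℤ, ∀ i, l ≤ i → (R i).leftOrthogonal X := by
  have monotone : Monotone fun i ↦ (R i).leftOrthogonal :=
    antitone_leftOrthogonal.comp h.metric.antitone
  have : compacts C ≤ ⨆ i, (R i).leftOrthogonal :=
    hG.generates ▸ smallGen_le_iSup monotone.directed_le
      fun n _ ↦ ⟨A - n, fun X hX Y f hY ↦ h.hom_eq_zero_of_le n (A - n) (by lia) Y hY f hX⟩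
  exact ((ObjectProperty.prop_iSup_iff _ X).1 (this X hX)).imp fun l hl i hi ↦ monotone hi X hl

lemma IsQuasiapproximableWith.exists_leftOrthogonal_metricR (h : IsQuasiapproximableWith G R A)
    (hG : IsGeneratingSequence G) {X : C} (hX : compacts C X) :
    ∃ l : ℤ, ∀ i, l ≤ i → (metricR G i).leftOrthogonal X := by
  obtain ⟨l, hl⟩ := h.exists_leftOrthogonal hG hX
  exact ⟨l + A, fun i hi ↦ antitone_leftOrthogonal (h.metricR_le hi) X (hl l le_rfl)⟩

lemma IsPreapproximableWith.exists_metricM_le_shift (h : IsPreapproximableWith G R A) (i : ℤ) :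
    ∃ n : ℤ, metricM G i ≤ (metricM G (i + 1)).shift n := by
  obtain ⟨n, -, hn⟩ := exists_le_of_forall_exists (P := metricM G i)
    (Q := fun n ↦ (metricM G (i + 1)).shift n) (s := Finset.Icc (-A : ℤ) A) fun X hX ↦ by
      obtain ⟨n, hn, Y, hY, ⟨e⟩⟩ := h.shift_bound i X hX
      rw [abs_le] at hn
      refine ⟨-n, Finset.mem_Icc.2 ⟨by lia, by lia⟩, (metricM G (i + 1)).prop_of_iso ?_ hY⟩
      exact ((shiftFunctor C (-n)).mapIso e ≪≫ shiftShiftNeg Y n).symm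
  exact ⟨n, hn⟩

lemma IsPreapproximableWith.exists_metricM_le_shift_of_le (h : IsPreapproximableWith G R A)
    {i l : ℤ} (hil : i ≤ l) : ∃ t : ℤ, metricM G i ≤ (metricM G l).shift t := by
  induction l, hil using Int.leInduction with
  | base => exact ⟨0, (ObjectProperty.shift_zero (A := ℤ) (metricM G i)).ge⟩
  | succ l _ ih =>
    obtain ⟨t, ht⟩ := ih
    obtain ⟨n, hn⟩ := h.exists_metricM_le_shift l
    exact ⟨t + n, fun X hX ↦ (metricM G (l + 1)).prop_of_iso
      ((shiftFunctorAdd C t n).app X).symm (hn _ (ht X hX))⟩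

lemma IsPreapproximableWith.exists_metricR_le_shift_odd (h : IsPreapproximableWith G R A)
    (hG : IsGeneratingSequence G) (i l : ℤ) :
    ∃ t : ℤ, metricR G i ≤ (metricR G l).shift (2 * t + 1) := by
  obtain ⟨t, ht⟩ := h.exists_metricM_le_shift_of_le (le_max_left i (l + 1))
  have ht' : metricM G i ≤ (metricM G (l + 1)).shift t :=
    fun X hX ↦ antitone_metricM G (le_max_right i (l + 1)) _ (ht X hX)
  obtain ⟨s, rfl | rfl⟩ := Int.even_or_odd' t
  · refine ⟨s, leftOrthogonal_rightOrthogonal_le_shift fun X hX ↦ ?_⟩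
    exact (metricM G l).prop_of_iso ((shiftFunctorAdd' C (2 * s) 1 (2 * s + 1) rfl).app X).symm
      (metricM_add_one_le_shift hG.shift_pos l _ (ht' X hX))
  · exact ⟨s, leftOrthogonal_rightOrthogonal_le_shift fun X hX ↦
      antitone_metricM G (Int.le_add_one le_rfl) _ (ht' X hX)⟩

end Metrics

section ClosedProperties

variable {C : Type u} [Category.{v} C] [HasShift C ℤ] {P : ObjectProperty C}
  [P.IsClosedUnderIsomorphisms]

lemma isStableUnderShift_int (h : P ≤ P.shift (1 : ℤ)) (h' : P ≤ P.shift (-1 : ℤ)) :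
    P.IsStableUnderShift ℤ where
  isStableUnderShiftBy n := ⟨fun X hX ↦ by
    induction n using Int.induction_on with
    | zero => exact P.prop_of_iso ((shiftFunctorZero C ℤ).app X).symm hX
    | succ i hi => exact P.prop_of_iso ((shiftFunctorAdd C (i : ℤ) 1).app X).symm (h _ hi)
    | pred i hi =>
      exact P.prop_of_iso ((shiftFunctorAdd' C (-i : ℤ) (-1) _ rfl).app X).symm (h' _ hi)⟩

variable [Preadditive C] [HasZeroObject C] [∀ n : ℤ, (shiftFunctor C n).Additive]
  [Pretriangulated C]

lemma prop_shift_biprod [P.IsStableUnderShift ℤ] {X Y : C} (h : P (X ⊞ Y)) (n : ℤ) :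
    P (X⟦n⟧ ⊞ Y⟦n⟧) :=
  have : PreservesBinaryBiproducts (shiftFunctor C n) :=
    preservesBinaryBiproducts_of_preservesBiproducts _
  P.prop_of_iso ((shiftFunctor C n).mapBiprod X Y) (P.le_shift n _ h)

variable [IsTriangulated C] [P.IsTriangulatedClosed₂]

lemma prop_biprod_of_biprod {X Y Y' Z : C} (e : Y⟦(1 : ℤ)⟧ ≅ Y') (h₁ : P (X ⊞ Y))
    (h₂ : P (Y' ⊞ Z)) : P (X ⊞ Z) := by
  obtain ⟨W, a, b, hW⟩ := distinguished_cocone_triangle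
    ((biprod.snd : Y ⊞ X ⟶ X) ≫ (biprod.inl : X ⟶ X ⊞ Z))
  let octahedron := Triangulated.someOctahedron rfl
    (rot_of_distTriang _ (binaryBiproductTriangle_distinguished Y X))
    (binaryBiproductTriangle_distinguished X Z) hW
  obtain ⟨e', -, -⟩ := exists_iso_binaryBiproduct_of_distTriang _ octahedron.mem zero_comp
  exact P.ext_of_isTriangulatedClosed₂ _ hW (P.prop_of_iso (biprod.braiding X Y) h₁)
    (P.prop_of_iso (e' ≪≫ biprod.mapIso e (Iso.refl Z)).symm h₂)

lemma prop_biprod_odd_shift [P.IsStableUnderShift ℤ] {X : C} (hX : P (X ⊞ X⟦(1 : ℤ)⟧)) (m : ℤ) :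
    P (X ⊞ X⟦2 * m + 1⟧) := by
  have consecutive (a b : ℤ) (hab : a + 1 = b) : P (X⟦a⟧ ⊞ X⟦b⟧) :=
    P.prop_of_iso (biprod.mapIso (Iso.refl _) ((shiftFunctorAdd' C 1 a b (by lia)).app X).symm)
      (prop_shift_biprod hX a)
  have swap {Y Z : C} : P (Y ⊞ Z) → P (Z ⊞ Y) := P.prop_of_iso (biprod.braiding Y Z)
  induction m using Int.induction_on with
  | zero => simpa using hX
  | succ m ih =>
    exact prop_biprod_of_biprod ((shiftFunctorAdd' C (2 * m + 1 : ℤ) 1 _ rfl).symm.app X) ih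
      (consecutive _ _ (by lia))
  | pred m ih =>
    exact swap (prop_biprod_of_biprod ((shiftFunctorAdd' C (2 * -m : ℤ) 1 _ rfl).symm.app X)
      (consecutive _ _ (by lia)) (swap ih))

end ClosedProperties

section Closure

variable {C : Type u} [Category.{v} C] [Preadditive C] [HasZeroObject C] [HasShift C ℤ]
  [∀ n : ℤ, (shiftFunctor C n).Additive] [Pretriangulated C] {G R : ℤ → ObjectProperty C}

instance : (closureG G).IsClosedUnderIsomorphisms where
  of_iso e hX n := ObjectProperty.prop_of_iso _ e (hX n)

variable (G) in
lemma compacts_le_closureG : compacts C ≤ closureG G := fun X hX n ↦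
  ⟨_, _, _, _, _, contractible_distinguished X, hX, (metricR G n).prop_of_isZero (isZero_zero C)⟩

lemma exists_metricR_of_closureG (hG : IsGeneratingSequence G) {F : C} (hF : closureG G F) :
    ∃ b : ℤ, metricR G b F := by
  obtain ⟨E, D, f, g, w, hT, hE, hD⟩ := hF 0
  obtain ⟨b, hb⟩ := exists_metricM_of_compacts hG hE
  exact ⟨min b 0, (metricR G _).ext_of_isTriangulatedClosed₂ _ hT
    (metricM_le_metricR G _ _ (hb _ (min_le_left b 0)))
    (antitone_metricR G (min_le_right b 0) _ hD)⟩

lemma isStableUnderShift_closureG (hG : IsGeneratingSequence G) :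
    (closureG G).IsStableUnderShift ℤ := by
  have le_shift {t : ℤ} (h : ∀ n, metricR G (n + 1) ≤ (metricR G n).shift t) :
      closureG G ≤ (closureG G).shift t := fun X hX n ↦ by
    obtain ⟨E, D, f, g, w, hT, hE, hD⟩ := hX (n + 1)
    exact ⟨_, _, _, _, _, Triangle.shift_distinguished _ hT t, (compacts C).le_shift t E hE,
      h n D hD⟩
  exact isStableUnderShift_int (le_shift (metricR_add_one_le_shift_one hG))
    (le_shift (metricR_add_one_le_shift_neg_one hG))

lemma extensionProduct_metricR_compacts_le (hG : IsGeneratingSequence G) (l n : ℤ) :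
    (metricR G (max (l + 1) n)).extensionProduct (compacts C ⊓ (metricR G l).leftOrthogonal) ≤
      (compacts C).extensionProduct (metricR G n) := by
  rintro X ⟨D, E, f, g, w, hT, hD, hE, hEl⟩
  have hw : w = 0 := hEl w (metricR_add_one_le_shift_one hG l D
    (antitone_metricR G (le_max_left _ _) _ hD))
  obtain ⟨e, -, -⟩ := exists_iso_binaryBiproduct_of_distTriang _ hT hw
  refine ObjectProperty.prop_of_iso _ (e ≪≫ biprod.braiding D E).symm ?_
  exact ⟨_, _, _, _, _, binaryBiproductTriangle_distinguished E D, hE,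
    antitone_metricR G (le_max_right _ _) _ hD⟩

variable {A : ℕ} (h : IsQuasiapproximableWith G R A) (hG : IsGeneratingSequence G)
include h hG

lemma IsQuasiapproximableWith.isTriangulatedClosed₂_closureG [IsTriangulated C] :
    (closureG G).IsTriangulatedClosed₂ := .mk' fun T hT h₁ h₃ n ↦ by
  obtain ⟨E, D, f, g, w, hT₃, hE, hD⟩ := h₃ n
  obtain ⟨l, hl⟩ := h.exists_leftOrthogonal_metricR hG hE
  have regroup : ((compacts C).extensionProduct (metricR G (max (l + 1) n))).extensionProduct
      ((compacts C ⊓ (metricR G l).leftOrthogonal).extensionProduct (metricR G n)) T.obj₂ :=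
    ⟨_, _, _, _, _, hT, h₁ _, E, D, f, g, w, hT₃, ⟨hE, hl l le_rfl⟩, hD⟩
  rw [ObjectProperty.extensionProduct_assoc,
    ← ObjectProperty.extensionProduct_assoc _ (_ ⊓ _)] at regroup
  have swapped := ObjectProperty.monotone_extensionProduct_right _
    (ObjectProperty.monotone_extensionProduct_left _
      (extensionProduct_metricR_compacts_le hG l n)) _ regroup
  rw [ObjectProperty.extensionProduct_assoc, ← ObjectProperty.extensionProduct_assoc] at swapped
  exact ObjectProperty.monotone_extensionProduct_left _
    (ObjectProperty.extensionProduct_le_of_isTriangulatedClosed₂ le_rfl le_rfl) _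
    (ObjectProperty.monotone_extensionProduct_right _
      (ObjectProperty.extensionProduct_le_of_isTriangulatedClosed₂ le_rfl le_rfl) _ swapped)

lemma IsQuasiapproximableWith.closureG_le_homFinite {k : Type w} [CommRing k] [Linear k C]
    (hhom : compacts C ≤ HomFinite k) : closureG G ≤ HomFinite k := by
  intro F hF Q hQ
  obtain ⟨l, hl⟩ := h.exists_leftOrthogonal_metricR hG hQ
  obtain ⟨E, D, f, g, w, hT, hE, hD⟩ := hF l
  have := hhom E hE Q hQ
  exact Module.Finite.of_surjective (Linear.rightComp k Q f) fun q ↦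
    (Triangle.coyoneda_exact₂ _ hT q (hl l le_rfl _ hD)).imp fun _ ↦ Eq.symm

end Closure

section Approximation

variable {C : Type u} [Category.{v} C] [Preadditive C] [HasZeroObject C] [HasShift C ℤ]
  [∀ n : ℤ, (shiftFunctor C n).Additive] [Pretriangulated C]

/-- The objects with a filtration of length `m` whose successive quotients are as in the
approximation triangles of a `G`-quasiapproximable category at the indices `i`, …, `i + m - 1`. -/
def approxClass (G : ℤ → ObjectProperty C) (A : ℕ) (i : ℤ) : ℕ → ObjectProperty C
  | 0 => IsZero
  | m + 1 => (bigGen G (Set.Icc (-A - i) (A - i)) A).extensionProduct (approxClass G A (i + 1) m)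

variable {G R : ℤ → ObjectProperty C} {A : ℕ}

lemma approxClass_le_leftOrthogonal {P : ObjectProperty C} {i : ℤ} {m : ℕ}
    (hP : ∀ n, -A - i - m < n → n ≤ A - i → G n ≤ P.leftOrthogonal) :
    approxClass G A i m ≤ P.leftOrthogonal := by
  induction m generalizing i with
  | zero => exact fun X hX _ _ _ ↦ IsZero.eq_of_src hX _ _
  | succ m ih =>
    exact ObjectProperty.extensionProduct_le_of_isTriangulatedClosed₂
      (bigGen_le_leftOrthogonal (fun n hn ↦ hP n (by push_cast; grind) hn.2) _)
      (ih fun n h₁ h₂ ↦ hP n (by push_cast; lia) (by lia))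

namespace IsQuasiapproximableWith

variable (h : IsQuasiapproximableWith G R A)
include h

lemma extensionProduct_approxClass [IsTriangulated C] (i : ℤ) (m : ℕ) :
    R i ⊓ closureG G ≤ (approxClass G A i m).extensionProduct (R (i + m) ⊓ closureG G) := by
  induction m generalizing i with
  | zero =>
    refine fun F hF ↦ ⟨_, F, _, 𝟙 F, _, contractible_distinguished₁ F, isZero_zero C, ?_⟩
    simpa using hF
  | succ m ih =>
    rintro F ⟨hF, hF'⟩
    obtain ⟨E, D, a, b, c, hT, hE, hD⟩ := h.approx i F hF hF'
    rw [approxClass, ObjectProperty.extensionProduct_assoc,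
      show i + (m + 1 : ℕ) = i + 1 + m by push_cast; ring]
    exact ⟨E, D, a, b, c, hT, hE, ih (i + 1) D hD⟩

lemma metricR_le_rightOrthogonal (b : ℤ) :
    metricR G b ≤ (union G (Set.Ici (2 * A - b))).rightOrthogonal := by
  rintro F hF X f ⟨n, hn : _ ≤ n, hX⟩
  exact h.hom_eq_zero_of_le n (b - A) (by lia) F (h.metricR_le (by lia) F hF) f hX

variable (hG : IsGeneratingSequence G)
include hG

lemma exists_rightOrthogonal_of_closureG {F : C} (hF : closureG G F) :
    ∃ N : ℤ, (union G (Set.Ici N)).rightOrthogonal F :=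
  have ⟨b, hb⟩ := exists_metricR_of_closureG hG hF
  ⟨2 * A - b, h.metricR_le_rightOrthogonal b F hb⟩

lemma exists_comp_eq_of_closureG {E D : C} (hE : compacts C E) (u : E ⟶ D) {j : ℤ}
    (hD : R j D) (hD' : closureG G D) :
    ∃ (K : C) (x : K ⟶ D) (t : E ⟶ K), t ≫ x = u ∧ compacts C K ∧ R j K := by
  obtain ⟨l, hl⟩ := h.exists_leftOrthogonal_metricR hG hE
  obtain ⟨K, Q, x, g, w, hT, hK, hQ⟩ := hD' (max l (j + A + 1))
  obtain ⟨t, ht⟩ := Triangle.coyoneda_exact₂ _ hT u (hl _ (le_max_left _ _) _ hQ)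
  have hQ' : R j (Q⟦(-1 : ℤ)⟧) := h.metricR_le le_rfl _
    (metricR_add_one_le_shift_neg_one hG _ _ (antitone_metricR G (le_max_right _ _) _ hQ))
  have := h.metric.isTriangulatedClosed₂ j
  have := h.metric.iso_closed j
  exact ⟨K, x, t, ht.symm, hK,
    (R j).ext_of_isTriangulatedClosed₂ _ (inv_rot_of_distTriang _ hT) hQ' hD⟩

variable [IsTriangulated C]

lemma metricR_of_compacts {j : ℤ} {K : C} (hK : compacts C K) (hK' : R j K) :
    metricR G (j - A) K := by
  obtain ⟨l, hl⟩ := h.exists_leftOrthogonal hG hK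
  obtain ⟨P, D, a, b, c, hT, hP, hD, -⟩ := h.extensionProduct_approxClass j (l - j).toNat K
    ⟨hK', compacts_le_closureG G K hK⟩
  obtain ⟨s, hs⟩ := Triangle.coyoneda_exact₂ _ hT (𝟙 K) (hl _ (by lia) _ hD)
  have hP' : metricR G (j - A) P := approxClass_le_leftOrthogonal (fun n _ hn X hX ↦
    metricM_le_metricR G (j - A) X (le_smallGen (by simp only [Set.mem_Iic]; lia) X hX)) P hP
  exact (metricR G (j - A)).prop_of_retract ⟨s, a, hs.symm⟩ hP'

lemma exists_comp_eq_of_rightOrthogonal {N : ℤ} {F : C}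
    (hF : (union G (Set.Ici N)).rightOrthogonal F) {E : C} (hE : compacts C E) (x : E ⟶ F) :
    ∃ (D : C) (u : E ⟶ D) (y : D ⟶ F), u ≫ y = x ∧ R (1 - A - N) D ∧ closureG G D := by
  obtain ⟨b, hb⟩ := exists_metricM_of_compacts hG hE
  let i : ℤ := min (b - A) (1 - A - N)
  obtain ⟨P, D, p, u, c, hT, hP, hD, hD'⟩ := h.extensionProduct_approxClass i (1 - A - N - i).toNat
    E ⟨(h.metricM_le i E (hb _ (by lia))).1, compacts_le_closureG G E hE⟩
  have hPF : (ObjectProperty.singleton F).leftOrthogonal P :=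
    approxClass_le_leftOrthogonal (fun n hn _ X hX Y f hY ↦ by
      obtain rfl := (ObjectProperty.singleton_iff _ _).1 hY
      exact hF f ⟨n, Set.mem_Ici.2 (by lia), hX⟩) P hP
  obtain ⟨y, hy⟩ := Triangle.yoneda_exact₂ _ hT x (hPF _ ((ObjectProperty.singleton_iff _ _).2 rfl))
  exact ⟨D, u, y, hy.symm, h.metric.antitone (by lia) D hD, hD'⟩

lemma exists_comp_eq_of_compacts {N : ℤ} {F : C}
    (hF : (union G (Set.Ici N)).rightOrthogonal F) {E : C} (hE : compacts C E) (x : E ⟶ F) :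
    ∃ (K : C) (y : K ⟶ F) (t : E ⟶ K), t ≫ y = x ∧ compacts C K ∧
      metricR G (1 - 2 * A - N) K := by
  obtain ⟨D, u, y, rfl, hD, hD'⟩ := h.exists_comp_eq_of_rightOrthogonal hG hF hE x
  obtain ⟨K, x, t, rfl, hK, hKR⟩ := h.exists_comp_eq_of_closureG hG hE u hD hD'
  refine ⟨K, x ≫ y, t, (Category.assoc _ _ _).symm, hK, ?_⟩
  convert h.metricR_of_compacts hG hK hKR using 1
  lia

end IsQuasiapproximableWith

lemma IsQuasiapproximableWith.metricR_of_rightOrthogonal [IsTriangulated C]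
    [HasColimitsOfShape (Discrete ℕ) C] (h : IsQuasiapproximableWith G R A)
    {k : Type w} [CommRing k] [Linear k C] [IsNoetherianRing k] (hC : IsCompactlyGenerated C)
    (hG : IsFiniteGeneratingSequence G) (hhom : compacts C ≤ HomFinite k) {F : C}
    (hF : HomFinite k F) {N : ℤ} (hN : (union G (Set.Ici N)).rightOrthogonal F) :
    metricR G (-2 * A - N) F := by
  obtain ⟨X, c, hX, hc, ⟨e⟩⟩ := exists_isHomotopyColimit_of_homFinite hC hG hhom hF
    fun E x hE ↦ h.exists_comp_eq_of_compacts hG.1 hN hE x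
  refine (metricR G _).prop_of_iso e (hc.leftOrthogonal_pt (fun j ↦ ?_) fun j ↦ ?_)
  · exact antitone_metricR G (by lia) _ (hX j).2
  · exact metricR_add_one_le_shift_one hG.1 _ _ (antitone_metricR G (by lia) _ (hX j).2)

end Approximation

section Lifting

variable {C : Type u} [Category.{v} C] {E E' F : C}

/-- The objects `B` such that all the morphisms `B ⟶ F` lift along `p : E ⟶ F`. -/
def liftable (p : E ⟶ F) : ObjectProperty C :=
  fun B ↦ ∀ f : B ⟶ F, ∃ g : B ⟶ E, g ≫ p = f

/-- The objects `Q` such that `t` kills all the morphisms `Q ⟶ E` killed by `p`. -/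
def kernelLE [HasZeroMorphisms C] (p : E ⟶ F) (t : E ⟶ E') : ObjectProperty C :=
  fun Q ↦ ∀ q : Q ⟶ E, q ≫ p = 0 → q ≫ t = 0

instance (p : E ⟶ F) : (liftable p).IsStableUnderRetracts where
  of_retract r hB f := by
    obtain ⟨g, hg⟩ := hB (r.r ≫ f)
    exact ⟨r.i ≫ g, by rw [Category.assoc, hg, r.retract_assoc]⟩

lemma liftable_le {p : E ⟶ F} {p' : E' ⟶ F} {t : E ⟶ E'} (ht : t ≫ p' = p) :
    liftable p ≤ liftable p' := fun B hB f ↦ by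
  obtain ⟨g, rfl⟩ := hB f
  exact ⟨g ≫ t, by rw [Category.assoc, ht]⟩

lemma allSums_le_liftable {U : ObjectProperty C} {p : E ⟶ F} (hU : U ≤ liftable p) :
    allSums U ≤ liftable p := by
  rintro B ⟨J, ⟨π⟩⟩ f
  choose g hg using fun j ↦ hU _ (π.prop_diag_obj j) (π.ι.app j ≫ f)
  exact ⟨π.isColimit.desc ⟨E, Discrete.natTrans g⟩, π.isColimit.hom_ext fun j ↦
    (π.isColimit.fac_assoc _ _ _).trans (hg j)⟩

variable [HasZeroMorphisms C]

instance (p : E ⟶ F) (t : E ⟶ E') : (kernelLE p t).IsStableUnderRetracts where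
  of_retract r hQ q hq := by
    have := hQ (r.r ≫ q) (by rw [Category.assoc, hq, comp_zero])
    rw [← r.retract_assoc (q ≫ t), ← Category.assoc r.r, this, comp_zero]

lemma kernelLE_le {E'' : C} (p : E ⟶ F) (t : E ⟶ E') (u : E' ⟶ E'') :
    kernelLE p t ≤ kernelLE p (t ≫ u) :=
  fun _ hQ q hq ↦ by rw [← Category.assoc, hQ q hq, zero_comp]

end Lifting

section Extension

variable {C : Type u} [Category.{v} C] [Preadditive C] [HasZeroObject C] [HasShift C ℤ]
  [∀ n : ℤ, (shiftFunctor C n).Additive] [Pretriangulated C]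

/-- The middle term `B` of a triangle `B₁ ⟶ B ⟶ B₂` inherits liftings from `B₁` and `B₂` once the
obstruction `B₂⟦-1⟧ ⟶ W` to extending the lifting from `B₁` is killed by passing to the cone `E`
of `W₀ ⟶ W ⟶ E₁`. -/
lemma extensionProduct_le_liftable {F E₁ E₂ W W₀ E : C} {p₁ : E₁ ⟶ F} {p₂ : E₂ ⟶ F}
    {i : W ⟶ E₁} {w : F ⟶ W⟦(1 : ℤ)⟧} (hW : Triangle.mk i p₁ w ∈ distTriang C) {q : W₀ ⟶ W}
    {e : E₁ ⟶ E} {c : E ⟶ W₀⟦(1 : ℤ)⟧} (hE : Triangle.mk (q ≫ i) e c ∈ distTriang C)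
    {p : E ⟶ F} (hp : e ≫ p = p₁) {P₁ P₂ : ObjectProperty C} (h₁ : P₁ ≤ liftable p₁)
    (h₂ : P₂ ≤ liftable p₂) (hq : P₂ ≤ (liftable q).shift (-1 : ℤ)) :
    P₁.extensionProduct P₂ ≤ liftable (biprod.desc p p₂) := by
  rintro B ⟨B₁, B₂, f, g, h, hT, hB₁, hB₂⟩ b
  have hT' := inv_rot_of_distTriang _ hT
  let δ : B₂⟦(-1 : ℤ)⟧ ⟶ B₁ := (Triangle.mk f g h).invRotate.mor₁
  have hδ : δ ≫ f = 0 := comp_distTriang_mor_zero₁₂ _ hT'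
  obtain ⟨β, hβ⟩ := h₁ B₁ hB₁ (f ≫ b)
  have hδβ : (δ ≫ β) ≫ p₁ = 0 := by rw [Category.assoc, hβ, reassoc_of% hδ, zero_comp]
  obtain ⟨y, hy⟩ : ∃ y : B₂⟦(-1 : ℤ)⟧ ⟶ W, δ ≫ β = y ≫ i :=
    Triangle.coyoneda_exact₂ _ hW (δ ≫ β) hδβ
  obtain ⟨y₀, rfl⟩ := hq B₂ hB₂ y
  have hqi : (q ≫ i) ≫ e = 0 := comp_distTriang_mor_zero₁₂ _ hE
  have hδβe : δ ≫ β ≫ e = 0 := by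
    rw [reassoc_of% hy, ← Category.assoc q, hqi, comp_zero]
  obtain ⟨γ, hγ⟩ : ∃ γ : B ⟶ E, β ≫ e = f ≫ γ := Triangle.yoneda_exact₂ _ hT' (β ≫ e) hδβe
  have hfb : f ≫ (b - γ ≫ p) = 0 := by
    rw [Preadditive.comp_sub, ← reassoc_of% hγ, hp, hβ, sub_self]
  obtain ⟨b', hb'⟩ : ∃ b' : B₂ ⟶ F, b - γ ≫ p = g ≫ b' :=
    Triangle.yoneda_exact₂ _ hT (b - γ ≫ p) hfb
  obtain ⟨ε, rfl⟩ := h₂ B₂ hB₂ b'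
  exact ⟨biprod.lift γ (g ≫ ε), by simp [← hb']⟩

end Extension

section Covers

variable {C : Type u} [Category.{v} C] [Preadditive C] (k : Type w) [CommRing k] [Linear k C]

/-- Every `F` with finitely generated modules of morphisms from the compact objects admits a
morphism `E ⟶ F` from a compact object along which all the morphisms from the objects
satisfying `P` lift. -/
def HasCompactCovers (P : ObjectProperty C) : Prop :=
  ∀ F : C, HomFinite k F → ∃ (E : C) (p : E ⟶ F), compacts C E ∧ P ≤ liftable p

variable {k} in
lemma HasCompactCovers.retractClosure {P : ObjectProperty C} (hP : HasCompactCovers k P) :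
    HasCompactCovers k P.retractClosure := fun F hF ↦
  have ⟨E, p, hE, h⟩ := hP F hF
  ⟨E, p, hE, (ObjectProperty.retractClosure_le_iff _ _).2 h⟩

variable [HasShift C ℤ] [∀ n : ℤ, (shiftFunctor C n).Additive]
  [∀ n : ℤ, (shiftFunctor C n).Linear k]

variable {k} in
lemma HasCompactCovers.exists_le_shift_liftable {P : ObjectProperty C}
    (hP : HasCompactCovers k P) (n : ℤ) {F : C} (hF : HomFinite k F) :
    ∃ (E : C) (p : E ⟶ F), compacts C E ∧ P ≤ (liftable p).shift n := by
  obtain ⟨E, p, hE, h⟩ := hP _ ((HomFinite k).le_shift (-n) _ hF)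
  refine ⟨E⟦n⟧, p⟦n⟧' ≫ (shiftNegShift F n).hom, (compacts C).le_shift n _ hE, fun B hB f ↦ ?_⟩
  obtain ⟨g, hg⟩ := h B hB ((shiftFunctor C n).preimage (f ≫ (shiftNegShift F n).inv))
  exact ⟨g⟦n⟧', by rw [← Functor.map_comp_assoc, hg, Functor.map_preimage,
    Category.assoc, Iso.inv_hom_id, Category.comp_id]⟩

end Covers

section CoverConstructions

variable {C : Type u} [Category.{v} C] [Preadditive C] [HasZeroObject C] [HasShift C ℤ]
  [∀ n : ℤ, (shiftFunctor C n).Additive] [Pretriangulated C]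
  {k : Type w} [CommRing k] [Linear k C]

lemma HomFinite.exists_comp_eq [IsNoetherianRing k] (hhom : compacts C ≤ HomFinite k) {F : C}
    (hF : HomFinite k F) {U : Set (compacts C).FullSubcategory} (hU : U.Finite) {E : C}
    (hE : compacts C E) (x : E ⟶ F) :
    ∃ (E' : C) (x' : E' ⟶ F) (t : E ⟶ E'), t ≫ x' = x ∧ compacts C E' ∧
      ∀ Q ∈ U, (liftable x' ⊓ kernelLE x t) Q.obj := by
  let E₀ : (compacts C).FullSubcategory := ⟨E, hE⟩
  obtain ⟨b, f, hf⟩ := exists_hom_forall_resolves (isCohomological_compactYoneda k F) hU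
    (fun Q ↦ hF Q.obj Q.2) (fun Q E ↦ have := hhom E.obj E.2 Q.obj Q.2; inferInstance)
    (.mk (S := (compacts C).ι ⋙ compactYoneda k) (Y := E₀) ((compactYoneda k).map x))
  let x' : b.left.obj ⟶ F := evalAt b.hom b.left (𝟙 b.left.obj)
  have hx' : (compactYoneda k).map x' = b.hom :=
    compactYoneda_hom_ext_of_compact (Category.id_comp x')
  have hb {Q : (compacts C).FullSubcategory} (q : Q.obj ⟶ b.left.obj) :
      evalAt b.hom Q q = q ≫ x' := hx' ▸ rfl
  have ht : f.left.hom ≫ x' = x := by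
    have := (hb _).symm.trans (evalAt_hom_comp_left (Q := E₀) f (𝟙 E))
    rw [Category.id_comp] at this
    exact this.trans (Category.id_comp x)
  refine ⟨b.left.obj, x', f.left.hom, ht, b.left.2, fun Q hQ ↦ ⟨fun g ↦ ?_, (hf Q hQ).eq_zero⟩⟩
  obtain ⟨q, hq⟩ := (hf Q hQ).surjective g
  exact ⟨q, (hb q).symm.trans hq⟩

namespace HasCompactCovers

lemma allSums [IsNoetherianRing k] (hhom : compacts C ≤ HomFinite k) {U : ObjectProperty C}
    (hU : {X : C | U X}.Finite) (hU' : U ≤ compacts C) :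
    HasCompactCovers k (allSums U) := by
  intro F hF
  obtain ⟨E, x, _, _, hE, hx⟩ := hF.exists_comp_eq hhom (U := {Q | U Q.obj})
    (hU.preimage fun _ _ _ _ ↦ ObjectProperty.FullSubcategory.ext)
    ((compacts C).prop_of_isZero (isZero_zero C)) 0
  exact ⟨E, x, hE, allSums_le_liftable fun X hX ↦ (hx ⟨X, hU' X hX⟩ hX).1⟩

variable [∀ n : ℤ, (shiftFunctor C n).Linear k] [IsNoetherianRing k]
  (hhom : compacts C ≤ HomFinite k)
include hhom

lemma extensionProduct {P₁ P₂ : ObjectProperty C} (h₁ : HasCompactCovers k P₁)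
    (h₂ : HasCompactCovers k P₂) : HasCompactCovers k (P₁.extensionProduct P₂) := by
  intro F hF
  obtain ⟨E₁, p₁, hE₁, hp₁⟩ := h₁ F hF
  obtain ⟨E₂, p₂, hE₂, hp₂⟩ := h₂ F hF
  obtain ⟨W, i, w, hW⟩ := distinguished_cocone_triangle₁ p₁
  have hWF : HomFinite k W := (HomFinite k).ext_of_isTriangulatedClosed₂ _
    (inv_rot_of_distTriang _ hW) ((HomFinite k).le_shift (-1) _ hF) (hhom _ hE₁)
  obtain ⟨W₀, q, hW₀, hq⟩ := h₂.exists_le_shift_liftable (-1) hWF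
  obtain ⟨E, e, c, hE⟩ := distinguished_cocone_triangle (q ≫ i)
  have hip₁ : i ≫ p₁ = 0 := comp_distTriang_mor_zero₁₂ _ hW
  have hqip₁ : (q ≫ i) ≫ p₁ = 0 := by rw [Category.assoc, hip₁, comp_zero]
  obtain ⟨p, hp⟩ : ∃ p : E ⟶ F, p₁ = e ≫ p := Triangle.yoneda_exact₂ _ hE p₁ hqip₁
  exact ⟨E ⊞ E₂, biprod.desc p p₂, (compacts C).ext_of_isTriangulatedClosed₂ _
      (binaryBiproductTriangle_distinguished _ _)
      ((compacts C).ext_of_isTriangulatedClosed₃ _ hE hW₀ hE₁) hE₂,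
    extensionProduct_le_liftable hW hE hp.symm hp₁ hp₂ hq⟩

lemma extensionProductIter {P : ObjectProperty C} (hP : HasCompactCovers k P) (n : ℕ) :
    HasCompactCovers k (P.extensionProductIter n) := by
  induction n with
  | zero => exact hP
  | succ n ih =>
    rw [ObjectProperty.extensionProductIter_succ]
    exact hP.extensionProduct hhom ih

lemma approxClass {G : ℤ → ObjectProperty C} (hG : IsFiniteGeneratingSequence G) (A : ℕ)
    (i : ℤ) (m : ℕ) : HasCompactCovers k (approxClass G A i m) := by
  induction m generalizing i with
  | zero =>
    exact fun F _ ↦ ⟨_, 0, (compacts C).prop_of_isZero (isZero_zero C),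
      fun B hB f ↦ ⟨0, IsZero.eq_of_src hB _ _⟩⟩
  | succ m ih =>
    have hU : HasCompactCovers k (GApprox.allSums (union G (Set.Icc (-A - i) (A - i)))) :=
      .allSums hhom
        (((Set.finite_Icc (-A - i) (A - i)).biUnion fun n _ ↦ hG.finite n).subset
          fun X ⟨n, hn, hX⟩ ↦ Set.mem_biUnion hn hX)
        fun X ⟨n, _, hX⟩ ↦ hG.le_compacts n X hX
    exact (hU.extensionProductIter hhom (A - 1)).retractClosure.extensionProduct hhom (ih (i + 1))

end HasCompactCovers

end CoverConstructions

section SplittingCone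

variable {C : Type u} [Category.{v} C] [Preadditive C] [HasZeroObject C] [HasShift C ℤ]
  [∀ n : ℤ, (shiftFunctor C n).Additive] [Pretriangulated C]

lemma hom_shift_obj₃_eq_zero {T : Triangle C} (hT : T ∈ distTriang C) {Q : C}
    (hs : liftable T.mor₁ (Q⟦(1 : ℤ)⟧)) (hi : ∀ y : Q ⟶ T.obj₁, y ≫ T.mor₁ = 0 → y = 0)
    (x : Q⟦(1 : ℤ)⟧ ⟶ T.obj₃) : x = 0 := by
  obtain ⟨z, hz⟩ := (shiftFunctor C (1 : ℤ)).map_surjective (x ≫ T.mor₃)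
  have hz₀ : z = 0 := hi z ((shiftFunctor C (1 : ℤ)).map_injective (by
    rw [Functor.map_comp, hz, Category.assoc, comp_distTriang_mor_zero₃₁ _ hT, comp_zero,
      Functor.map_zero]))
  obtain ⟨f, rfl⟩ := Triangle.coyoneda_exact₃ _ hT x (by rw [← hz, hz₀, Functor.map_zero])
  obtain ⟨y, rfl⟩ := hs f
  rw [Category.assoc, comp_distTriang_mor_zero₁₂ _ hT, comp_zero]

variable {F E₀ E₁ P K T : C} {p₀ : E₀ ⟶ F} {p₁ : E₁ ⟶ F} {a : E₀ ⟶ E₁}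
  {ι : P ⟶ E₁} {κ : E₁ ⟶ K} {δ : K ⟶ P⟦(1 : ℤ)⟧} (hK : Triangle.mk ι κ δ ∈ distTriang C)
  {v : P ⟶ E₀} (hv : v ≫ p₀ = ι ≫ p₁) {c : E₁ ⟶ T} {d : T ⟶ P⟦(1 : ℤ)⟧}
  (hT : Triangle.mk (ι - v ≫ a) c d ∈ distTriang C) {q : T ⟶ F} (hq : c ≫ q = p₁) {Q : C}
include hK hv hT hq

lemma eq_zero_of_comp_lift_eq_zero (hQ : kernelLE p₀ a Q) (hQ₁ : kernelLE p₀ a (Q⟦(1 : ℤ)⟧))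
    (hQK : ∀ f : Q⟦(1 : ℤ)⟧ ⟶ K, f = 0) (y : Q⟦(1 : ℤ)⟧ ⟶ T)
    (hy : y ≫ biprod.lift q (d ≫ (ι ≫ p₁)⟦(1 : ℤ)⟧') = 0) : y = 0 := by
  have hyq : y ≫ q = 0 := by simpa using hy =≫ biprod.fst
  obtain ⟨z, hz⟩ := (shiftFunctor C (1 : ℤ)).map_surjective (y ≫ d)
  have hzp : z ≫ ι ≫ p₁ = 0 := (shiftFunctor C (1 : ℤ)).map_injective (by
    have := hy =≫ biprod.snd
    rw [Category.assoc, biprod.lift_snd, ← Category.assoc, ← hz, zero_comp] at this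
    rw [Functor.map_comp, this, Functor.map_zero])
  have hdι : d ≫ (ι - v ≫ a)⟦(1 : ℤ)⟧' = 0 := comp_distTriang_mor_zero₃₁ _ hT
  have hzι : z ≫ (ι - v ≫ a) = 0 := (shiftFunctor C (1 : ℤ)).map_injective (by
    rw [Functor.map_comp, hz, Category.assoc, hdι, comp_zero, Functor.map_zero])
  have hzv : z ≫ v ≫ a = 0 := (Category.assoc _ _ _).symm.trans
    (hQ (z ≫ v) (by rw [Category.assoc, hv, hzp]))
  rw [Preadditive.comp_sub, hzv, sub_zero] at hzι
  have hyd : y ≫ d = 0 := by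
    have hydι : (y ≫ d) ≫ ι⟦(1 : ℤ)⟧' = 0 := by
      rw [← hz, ← Functor.map_comp, hzι, Functor.map_zero]
    obtain ⟨r, hr⟩ : ∃ r : Q⟦(1 : ℤ)⟧ ⟶ K, y ≫ d = r ≫ δ :=
      Triangle.coyoneda_exact₁ _ hK (y ≫ d) hydι
    rw [hr, hQK r, zero_comp]
  obtain ⟨y', rfl⟩ : ∃ y' : Q⟦(1 : ℤ)⟧ ⟶ E₁, y = y' ≫ c := Triangle.coyoneda_exact₃ _ hT y hyd
  obtain ⟨r, rfl⟩ : ∃ r : Q⟦(1 : ℤ)⟧ ⟶ P, y' = r ≫ ι := Triangle.coyoneda_exact₂ _ hK y' (hQK _)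
  have hrv : (r ≫ v) ≫ a = 0 := hQ₁ (r ≫ v) (by
    rw [Category.assoc, hv, ← hq, ← Category.assoc r, ← Category.assoc (r ≫ ι), hyq])
  have hιc : (ι - v ≫ a) ≫ c = 0 := comp_distTriang_mor_zero₁₂ _ hT
  have hrιc := r ≫= hιc
  rwa [← Category.assoc, Preadditive.comp_sub, ← Category.assoc r v a, hrv, sub_zero,
    comp_zero] at hrιc

lemma liftable_lift (ha : a ≫ p₁ = p₀) (hQ : (liftable p₀ ⊓ kernelLE p₀ a) Q)
    (hQ₁ : liftable p₀ (Q⟦(1 : ℤ)⟧)) (hQK : ∀ f : Q ⟶ K, f = 0) :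
    liftable (biprod.lift q (d ≫ (ι ≫ p₁)⟦(1 : ℤ)⟧')) (Q⟦(1 : ℤ)⟧) := by
  intro f
  obtain ⟨g, hg⟩ := (shiftFunctor C (1 : ℤ)).map_surjective (f ≫ biprod.snd)
  obtain ⟨s, rfl⟩ := hQ.1 g
  obtain ⟨r, hr⟩ : ∃ r : Q ⟶ P, s ≫ a = r ≫ ι := Triangle.coyoneda_exact₂ _ hK (s ≫ a) (hQK _)
  have hsr : (s - r ≫ v) ≫ a = 0 := hQ.2 (s - r ≫ v) (by
    rw [Preadditive.sub_comp, Category.assoc, hv, ← reassoc_of% hr, ha, sub_self])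
  have hr₀ : r ≫ (ι - v ≫ a) = 0 := by
    rwa [Preadditive.comp_sub, ← hr, ← Category.assoc, ← Preadditive.sub_comp]
  have hr₁ : r⟦(1 : ℤ)⟧' ≫ (ι - v ≫ a)⟦(1 : ℤ)⟧' = 0 := by
    rw [← Functor.map_comp, hr₀, Functor.map_zero]
  obtain ⟨y, hy⟩ : ∃ y : Q⟦(1 : ℤ)⟧ ⟶ T, r⟦(1 : ℤ)⟧' = y ≫ d :=
    Triangle.coyoneda_exact₁ _ hT (r⟦(1 : ℤ)⟧') hr₁
  obtain ⟨s₁, hs₁⟩ := hQ₁ (f ≫ biprod.fst - y ≫ q)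
  have hcd : c ≫ d = 0 := comp_distTriang_mor_zero₂₃ _ hT
  refine ⟨y + s₁ ≫ a ≫ c, biprod.hom_ext _ _ ?_ ?_⟩
  · simp [hq, ha, hs₁]
  · simp only [Category.assoc, biprod.lift_snd, Preadditive.add_comp, reassoc_of% hcd, zero_comp,
      comp_zero, add_zero, ← hg]
    rw [← reassoc_of% hy, ← Functor.map_comp, ← reassoc_of% hr, ha]

end SplittingCone

section Splitting

variable {C : Type u} [Category.{v} C] [Preadditive C] [HasZeroObject C] [HasShift C ℤ]
  [∀ n : ℤ, (shiftFunctor C n).Additive] [Pretriangulated C]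

/-- On the morphisms from the test objects `Q`, the inclusion `ι` is invertible and `v ≫ a` becomes
an idempotent `e` of `E₁` with image `F`; the cone of `1 - e` is then `F ⊞ F⟦1⟧`. -/
lemma exists_distTriang_biprod_shift {F E₀ E₁ P K : C} {p₀ : E₀ ⟶ F} {p₁ : E₁ ⟶ F}
    {a : E₀ ⟶ E₁} (ha : a ≫ p₁ = p₀) {ι : P ⟶ E₁} {κ : E₁ ⟶ K} {δ : K ⟶ P⟦(1 : ℤ)⟧}
    (hK : Triangle.mk ι κ δ ∈ distTriang C) {v : P ⟶ E₀} (hv : v ≫ p₀ = ι ≫ p₁)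
    (hP : compacts C P) (hE₁ : compacts C E₁) :
    ∃ (T X : C) (φ : T ⟶ F ⊞ F⟦(1 : ℤ)⟧) (ψ : F ⊞ F⟦(1 : ℤ)⟧ ⟶ X) (χ : X ⟶ T⟦(1 : ℤ)⟧),
      Triangle.mk φ ψ χ ∈ distTriang C ∧ compacts C T ∧
      ∀ ⦃Q : C⦄, (∀ t ∈ Set.Icc (-2 : ℤ) 0, (liftable p₀ ⊓ kernelLE p₀ a) (Q⟦t⟧)) →
        (∀ f : Q⟦(-1 : ℤ)⟧ ⟶ K, f = 0) → ∀ x : Q ⟶ X, x = 0 := by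
  obtain ⟨T, c, d, hT⟩ := distinguished_cocone_triangle (ι - v ≫ a)
  have hp₁ : (ι - v ≫ a) ≫ p₁ = 0 := by
    rw [Preadditive.sub_comp, Category.assoc, ha, hv, sub_self]
  obtain ⟨q, hq⟩ : ∃ q : T ⟶ F, p₁ = c ≫ q := Triangle.yoneda_exact₂ _ hT p₁ hp₁
  obtain ⟨X, ψ, χ, hX⟩ := distinguished_cocone_triangle
    (biprod.lift q (d ≫ (ι ≫ p₁)⟦(1 : ℤ)⟧'))
  refine ⟨T, X, _, ψ, χ, hX, (compacts C).ext_of_isTriangulatedClosed₃ _ hT hP hE₁,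
    fun Q hQ hQK x ↦ ?_⟩
  let e₁ : Q⟦(-1 : ℤ)⟧ ≅ Q⟦(-2 : ℤ)⟧⟦(1 : ℤ)⟧ := (shiftFunctorAdd' C (-2) 1 (-1) rfl).app Q
  let e₀ : Q⟦(-2 : ℤ)⟧⟦(1 : ℤ)⟧⟦(1 : ℤ)⟧ ≅ Q :=
    (shiftFunctor C (1 : ℤ)).mapIso e₁.symm ≪≫ shiftNegShift Q 1
  have hQ₀ := (liftable p₀).prop_of_iso ((shiftFunctorZero C ℤ).app Q ≪≫ e₀.symm)
    (hQ 0 (by simp)).1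
  have hQ₁ := (hQ (-1) (by simp)).imp ((liftable p₀).prop_of_iso e₁)
    ((kernelLE p₀ a).prop_of_iso e₁)
  have hQK' (f : Q⟦(-2 : ℤ)⟧⟦(1 : ℤ)⟧ ⟶ K) : f = 0 := by
    rw [← cancel_epi e₁.hom, hQK (e₁.hom ≫ f), comp_zero]
  rw [← cancel_epi e₀.hom, comp_zero]
  exact hom_shift_obj₃_eq_zero hX (liftable_lift hK hv hT hq.symm ha hQ₁ hQ₀ hQK')
    (eq_zero_of_comp_lift_eq_zero hK hv hT hq.symm (hQ (-2) (by simp)).2 hQ₁.2 hQK') _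

end Splitting

section Representability

variable {C : Type u} [Category.{v} C] [Preadditive C] [HasZeroObject C] [HasShift C ℤ]
  [∀ n : ℤ, (shiftFunctor C n).Additive] [Pretriangulated C]
  {G R : ℤ → ObjectProperty C} {A : ℕ}

lemma metricR_add_le_shift (hG : IsGeneratingSequence G) (b : ℤ) (j : ℕ) :
    metricR G (b + j) ≤ (metricR G b).shift (j : ℤ) := by
  induction j with
  | zero => simp [ObjectProperty.shift_zero]
  | succ j ih =>
    rw [← ObjectProperty.shift_shift (metricR G b) 1 (j : ℤ) (j + 1 : ℕ) (by push_cast; ring)]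
    refine fun F hF ↦ ih _ (metricR_add_one_le_shift_one hG _ F ?_)
    convert hF using 1
    push_cast
    ring

namespace IsQuasiapproximableWith

variable (h : IsQuasiapproximableWith G R A)
include h

lemma eq_zero_of_metricR (hG : IsGeneratingSequence G) {b n t : ℤ} (ht : t ≤ 0)
    (hn : 2 * A - b - t ≤ n) {F Q : C} (hF : metricR G b F) (hQ : G n Q) (f : Q⟦t⟧ ⟶ F) :
    f = 0 := by
  obtain ⟨j, rfl⟩ : ∃ j : ℕ, t = -j := ⟨t.natAbs, by lia⟩
  have hF' : metricR G (b - j) (F⟦-(-j : ℤ)⟧) := by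
    rw [neg_neg]
    exact metricR_add_le_shift hG (b - j) j F (by simpa)
  exact (hom_shift_eq_zero_iff (-j : ℤ)).2 (fun g ↦ h.metricR_le_rightOrthogonal (b - j) _ hF' g
    ⟨n, Set.mem_Ici.2 (by lia), hQ⟩) f

variable [IsTriangulated C]

lemma exists_distTriang_approxClass (hG : IsGeneratingSequence G) {i : ℤ} {E : C}
    (hE : compacts C E) (hE' : R i E) (m : ℕ) :
    ∃ (P K B : C) (ι : P ⟶ E) (κ : E ⟶ K) (δ : K ⟶ P⟦(1 : ℤ)⟧) (s : P ⟶ B) (r : B ⟶ E),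
      Triangle.mk ι κ δ ∈ distTriang C ∧ s ≫ r = ι ∧ compacts C P ∧ approxClass G A i m B ∧
        R (i + m) K := by
  obtain ⟨B, D, r, u, w, hT, hB, hD, hD'⟩ :=
    h.extensionProduct_approxClass i m E ⟨hE', compacts_le_closureG G E hE⟩
  obtain ⟨K, x, κ, rfl, hK, hKR⟩ := h.exists_comp_eq_of_closureG hG hE u hD hD'
  obtain ⟨P, ι, δ, hP⟩ := distinguished_cocone_triangle₁ κ
  have hικ : ι ≫ κ = 0 := comp_distTriang_mor_zero₁₂ _ hP
  have hιu : ι ≫ κ ≫ x = 0 := by rw [reassoc_of% hικ, zero_comp]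
  obtain ⟨s, hs⟩ : ∃ s : P ⟶ B, ι = s ≫ r := Triangle.coyoneda_exact₂ _ hT ι hιu
  exact ⟨P, K, B, ι, κ, δ, s, r, hP, hs.symm, (compacts C).ext_of_isTriangulatedClosed₁ _ hP hE hK,
    hB, hKR⟩

variable [HasColimitsOfShape (Discrete ℕ) C] {k : Type w} [CommRing k] [Linear k C]
  [IsNoetherianRing k] (hC : IsCompactlyGenerated C) (hG : IsFiniteGeneratingSequence G)
  (hhom : compacts C ≤ HomFinite k) {F : C} (hF : HomFinite k F) {N : ℤ}
  (hN : (union G (Set.Ici N)).rightOrthogonal F)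
include hC hG hhom hF hN

lemma exists_comp_eq_liftable_kernelLE {E : C} (hE : compacts C E)
    (hE' : metricR G (-2 * A - N) E) (x : E ⟶ F) (c : ℤ) :
    ∃ (E' : C) (x' : E' ⟶ F) (t : E ⟶ E'), t ≫ x' = x ∧ compacts C E' ∧
      metricR G (-2 * A - N) E' ∧ ∀ n, c ≤ n → ∀ Q, G n Q → ∀ s ∈ Set.Icc (-2 : ℤ) 0,
        (liftable x' ⊓ kernelLE x t) (Q⟦s⟧) := by
  let N' : ℤ := 4 * A + N + 2
  obtain ⟨E₁, x₁, t₁, rfl, hE₁, hx₁⟩ := hF.exists_comp_eq hhom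
    (finite_shiftedUnion hG.finite (c.natAbs + N'.natAbs + 2)) hE x
  obtain ⟨E₂, x₂, t₂, rfl, hE₂, hE₂'⟩ := h.exists_comp_eq_of_compacts hG.1 hN hE₁ x₁
  refine ⟨E₂, x₂, t₁ ≫ t₂, Category.assoc _ _ _, hE₂, antitone_metricR G (by lia) _ hE₂',
    fun n hn Q hQ s hs ↦ ?_⟩
  rw [Set.mem_Icc] at hs
  by_cases hnN : n ≤ N'
  · have hQs := hx₁ ⟨Q⟦s⟧, (compacts C).le_shift s Q (hG.le_compacts n Q hQ)⟩
      ⟨n, Finset.mem_Icc.2 (by lia), s, Finset.mem_Icc.2 (by lia), Q, hQ, rfl⟩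
    exact hQs.imp (liftable_le rfl _) (kernelLE_le _ _ _ _)
  · have eq_zero {Y : C} (hY : metricR G (-2 * A - N) Y) (f : Q⟦s⟧ ⟶ Y) : f = 0 :=
      h.eq_zero_of_metricR hG.1 hs.2 (by lia) hY hQ f
    exact ⟨fun f ↦ ⟨0, by rw [eq_zero (h.metricR_of_rightOrthogonal hC hG hhom hF hN) f,
      zero_comp]⟩, fun q _ ↦ by rw [eq_zero hE' q, zero_comp]⟩

variable [∀ n : ℤ, (shiftFunctor C n).Linear k]

lemma exists_presentation (i : ℤ) (m : ℕ) (c : ℤ) :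
    ∃ (E₀ E₁ : C) (p₀ : E₀ ⟶ F) (p₁ : E₁ ⟶ F) (a : E₀ ⟶ E₁), a ≫ p₁ = p₀ ∧ compacts C E₁ ∧
      metricR G (-2 * A - N) E₁ ∧ approxClass G A i m ≤ liftable p₀ ∧
      ∀ n, c ≤ n → ∀ Q, G n Q → ∀ t ∈ Set.Icc (-2 : ℤ) 0,
        (liftable p₀ ⊓ kernelLE p₀ a) (Q⟦t⟧) := by
  obtain ⟨E, p, hE, hp⟩ := HasCompactCovers.approxClass hhom hG A i m F hF
  obtain ⟨E', p', t, rfl, hE', hE'R⟩ := h.exists_comp_eq_of_compacts hG.1 hN hE p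
  obtain ⟨E₀, p₀, t₀, rfl, hE₀, hE₀R, h₀⟩ := h.exists_comp_eq_liftable_kernelLE hC hG hhom hF hN
    hE' (antitone_metricR G (by lia) _ hE'R) p' c
  obtain ⟨E₁, p₁, a, ha, hE₁, hE₁R, h₁⟩ := h.exists_comp_eq_liftable_kernelLE hC hG hhom hF hN
    hE₀ hE₀R p₀ c
  exact ⟨E₀, E₁, p₀, p₁, a, ha, hE₁, hE₁R, hp.trans (liftable_le (Category.assoc _ _ _)),
    fun n hn Q hQ s hs ↦ ⟨(h₀ n hn Q hQ s hs).1, (h₁ n hn Q hQ s hs).2⟩⟩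

lemma closureG_biprod_shift : closureG G (F ⊞ F⟦(1 : ℤ)⟧) := by
  intro l
  let i : ℤ := -3 * A - N
  let m : ℕ := (3 * A + 1 + l - i).toNat
  obtain ⟨E₀, E₁, p₀, p₁, a, ha, hE₁, hE₁R, hp₀, htest⟩ :=
    h.exists_presentation hC hG hhom hF hN i m (-2 * A - l)
  obtain ⟨P, K, B, ι, κ, δ, s, r, hK, rfl, hP, hB, hKR⟩ :=
    h.exists_distTriang_approxClass hG.1 hE₁ (h.metricR_le (i := i) (by lia) _ hE₁R) m
  obtain ⟨v, hv⟩ := hp₀ B hB (r ≫ p₁)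
  obtain ⟨T, X, φ, ψ, χ, hX, hT, hXQ⟩ := exists_distTriang_biprod_shift ha hK (v := s ≫ v)
    (by rw [Category.assoc, hv, Category.assoc]) hP hE₁
  have hFF : HomFinite k (F ⊞ F⟦(1 : ℤ)⟧) := (HomFinite k).ext_of_isTriangulatedClosed₂ _
    (binaryBiproductTriangle_distinguished _ _) hF ((HomFinite k).le_shift 1 _ hF)
  have hXF : HomFinite k X := (HomFinite k).ext_of_isTriangulatedClosed₂ _
    (rot_of_distTriang _ hX) hFF ((HomFinite k).le_shift 1 _ (hhom _ hT))
  have hKQ {n : ℤ} (hn : -2 * A - l ≤ n) {Q : C} (hQ : G n Q) (f : Q⟦(-1 : ℤ)⟧ ⟶ K) : f = 0 :=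
    (hom_shift_eq_zero_iff (-1)).2 (fun g ↦ h.hom_eq_zero_of_le n (i + m - 1) (by lia) _
      (h.metric.shift_pos (i + m - 1) K (by simpa using hKR)) g hQ) f
  refine ⟨T, X, φ, ψ, χ, hX, hT, ?_⟩
  convert h.metricR_of_rightOrthogonal hC hG hhom hXF (N := -2 * A - l) ?_ using 1
  · lia
  · rintro Q f ⟨n, hn, hQ⟩
    exact hXQ (htest n hn Q hQ) (hKQ hn hQ) f

/-- For a suitable `t` the summand `F⟦2 * t + 1⟧` is small in the metric, so removing it from
`F ⊞ F⟦2 * t + 1⟧` stays in the closure. -/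
lemma closureG_of_rightOrthogonal : closureG G F := by
  intro l
  have := isStableUnderShift_closureG hG.1
  have := h.isTriangulatedClosed₂_closureG hG.1
  obtain ⟨t, ht⟩ := h.exists_metricR_le_shift_odd hG.1 (-2 * A - N) (l + 1)
  have hFt : metricR G (l + 1) (F⟦2 * t + 1⟧) :=
    ht F (h.metricR_of_rightOrthogonal hC hG hhom hF hN)
  have hsum : closureG G (F⟦2 * t + 1⟧ ⊞ F) := (closureG G).prop_of_iso (biprod.braiding _ _)
    (prop_biprod_odd_shift (h.closureG_biprod_shift hC hG hhom hF hN) t)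
  have hF' : ((compacts C).extensionProduct (metricR G l)).extensionProduct (metricR G l) F :=
    ⟨_, _, _, _, _, rot_of_distTriang _ (binaryBiproductTriangle_distinguished _ F), hsum l,
      metricR_add_one_le_shift_one hG.1 l _ hFt⟩
  rw [ObjectProperty.extensionProduct_assoc] at hF'
  exact ObjectProperty.monotone_extensionProduct_right _
    (ObjectProperty.extensionProduct_le_of_isTriangulatedClosed₂ le_rfl le_rfl) _ hF'

end IsQuasiapproximableWith

end Representability

section Semifinite

variable {C : Type u} [Category.{v} C] [Preadditive C] [HasZeroObject C] [HasShift C ℤ]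
  [∀ n : ℤ, (shiftFunctor C n).Additive] [Pretriangulated C] {k : Type w} [CommRing k] [Linear k C]
  {H H' : (compacts C).FullSubcategoryᵒᵖ ⥤ ModuleCat.{v} k} {G R : ℤ → ObjectProperty C} {A : ℕ}

lemma IsCohomological.of_iso (hH : IsCohomological k H) (e : H ≅ H') : IsCohomological k H' where
  additive := have := hH.additive; Functor.additive_of_iso e
  map_smul {X Y} r f := by
    rw [← cancel_epi (e.hom.app (op Y)), ← e.hom.naturality, hH.map_smul, Linear.smul_comp,
      Linear.comp_smul, e.hom.naturality]
  exact f g h hT := by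
    have naturality {Q Q' : (compacts C).FullSubcategory} (f : Q ⟶ Q') :
        (H'.map f.op).hom.comp (e.app (op Q')).toLinearEquiv.toLinearMap =
          (e.app (op Q)).toLinearEquiv.toLinearMap.comp (H.map f.op).hom :=
      congrArg ModuleCat.Hom.hom (e.hom.naturality f.op).symm
    exact Function.Exact.of_ladder_linearEquiv_of_exact (naturality g) (naturality f)
      (hH.exact f g h hT)

lemma IsSemifinite.of_iso (hH : IsSemifinite k G H) (e : H ≅ H') : IsSemifinite k G H' where
  toIsCohomological := hH.toIsCohomological.of_iso e
  finite X := have := hH.finite X; Module.Finite.equiv (e.app (op X)).toLinearEquiv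
  vanishing := by
    obtain ⟨N, hN⟩ := hH.vanishing
    refine ⟨N, fun i hi X hX ↦ ?_⟩
    have := hN i hi X hX
    exact (e.app (op X)).toLinearEquiv.symm.injective.subsingleton

lemma IsQuasiapproximableWith.isSemifinite_compactYoneda_iff [IsTriangulated C]
    [HasColimitsOfShape (Discrete ℕ) C] [IsNoetherianRing k] [∀ n : ℤ, (shiftFunctor C n).Linear k]
    (h : IsQuasiapproximableWith G R A) (hC : IsCompactlyGenerated C)
    (hG : IsFiniteGeneratingSequence G) (hhom : compacts C ≤ HomFinite k) {F : C} :
    IsSemifinite k G ((compactYoneda k).obj F) ↔ closureG G F := by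
  refine ⟨fun hF ↦ ?_, fun hF ↦ ?_⟩
  · obtain ⟨N, hN⟩ := hF.vanishing
    refine h.closureG_of_rightOrthogonal hC hG hhom (fun X hX ↦ hF.finite ⟨X, hX⟩) (N := N) ?_
    rintro X f ⟨n, hn, hX⟩
    exact (hN n hn ⟨X, hG.le_compacts n X hX⟩ hX).elim f 0
  · obtain ⟨N, hN⟩ := h.exists_rightOrthogonal_of_closureG hG.1 hF
    have eq_zero {X : C} {n : ℤ} (hn : N ≤ n) (hX : G n X) (q : X ⟶ F) : q = 0 :=
      hN q ⟨n, hn, hX⟩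
    exact
      { isCohomological_compactYoneda k F with
        finite := fun X ↦ h.closureG_le_homFinite hG.1 hhom F hF X.obj X.2
        vanishing := ⟨N, fun n hn X hX ↦
          ⟨fun q q' ↦ (eq_zero hn hX q).trans (eq_zero hn hX q').symm⟩⟩ }

end Semifinite

end GApprox

end

theorem mainTheorem1 {C : Type u} [Category.{v} C] [Preadditive C] [HasZeroObject C]
    [HasShift C ℤ] [∀ n : ℤ, (shiftFunctor C n).Additive] [Pretriangulated C]
    [IsTriangulated C] [HasCoproducts.{v} C]
    (k : Type w) [CommRing k] [IsNoetherianRing k] [Linear k C]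
    [∀ n : ℤ, (shiftFunctor C n).Linear k]
    (hC : GApprox.IsCompactlyGenerated C)
    (G : ℤ → ObjectProperty C) (hG : GApprox.IsFiniteGeneratingSequence G)
    (hT : GApprox.IsQuasiapproximable G)
    (hfin : ∀ (m n : ℤ) (X Y : C), G m X → G n Y → Module.Finite k (X ⟶ Y)) :
    (∀ H : (GApprox.compacts C).FullSubcategoryᵒᵖ ⥤ ModuleCat.{v} k,
      (GApprox.restrictedYoneda k G).essImage H ↔ GApprox.IsSemifinite k G H) ∧
    (GApprox.restrictedYoneda k G).Full := by
  obtain ⟨R, A, h⟩ := hT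
  have : HasCoproducts.{0} C := hasCoproducts_shrink.{0, v}
  have hhom := GApprox.compacts_le_homFinite (k := k) hG.generates hfin
  have semifinite_iff {F : C} := h.isSemifinite_compactYoneda_iff hC hG hhom (F := F)
  refine ⟨fun H ↦ ⟨?_, fun hH ↦ ?_⟩, ⟨fun {F F'} η ↦ ?_⟩⟩
  · rintro ⟨F, ⟨e⟩⟩
    exact (semifinite_iff.2 F.property).of_iso e
  · obtain ⟨X, c, -, -, ⟨e⟩⟩ := GApprox.exists_isHomotopyColimit_iso hG hH.toIsCohomological
      hH.finite (fun Q E ↦ have := hhom E.obj E.2 Q.obj Q.2; inferInstance)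
      (P := ⊤) fun a ↦ ⟨a, 𝟙 a, trivial⟩
    exact ⟨⟨c.pt, semifinite_iff.1 (hH.of_iso e.symm)⟩, ⟨e⟩⟩
  · obtain ⟨f, hf⟩ := GApprox.compactYoneda_map_surjective_of_homFinite hC hG hhom
      (h.closureG_le_homFinite hG.1 hhom _ F.property) η
    exact ⟨ObjectProperty.homMk f, hf⟩
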